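/- \textbf{Theorem (Local $L^2$ Distribution Estimation: Asymptotic Normality).} Let $x_1,x_2,\dots$ be i.i.d. real random variables with distribution function $F$, let $\mathcal X$ be the support of $F$, and let $\mathsf x\in\mathcal X$. Let $K:\mathbb R\to[0,\infty)$ be symmetric, zero outside $[-1,1]$, continuous on $[-1,1]$, with $\int K=1$. Let $R:\mathbb R\to\mathbb R^d$ be measurable and locally bounded and, for each $h>0$, let $\Upsilon_h$ be a positive definite diagonal matrix with $\Upsilon_hR(u)=R(u/h)$ for all $u$. Let $G$ be a nondecreasing right-continuous weighting function. Let $\theta\in\mathbb R^d$, and put, for $h>0$, $$\varrho(h)=\sup_{|x-\mathsf x|\le h}\bigl|F(x)-R(x-\mathsf x)'\theta\bigr| ,\qquad \hat F(u)=\frac1n\sum_{i=1}^n \mathbf 1(x_i\le u),$$ $$\hat\theta_G\in\operatorname*{arg\,min}_{t\in\mathbb R^d}\int_{\mathcal X}\bigl(\hat F(u)-R(u-\mathsf x)'t\bigr)^2\,\frac1hK\Bigl(\frac{u-\mathsf x}{h}\Bigr)\,dG(u).$$ Assume: (a) For some $\delta>0$, $F$ is absolutely continuous on $[\mathsf x-\delta,\mathsf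 x+\delta]$ with a density $f\ge0$ there admitting constants $f(\mathsf x\pm),\dot f(\mathsf x\pm)$ such that $$\sup_{u\in[-\delta,0)}\frac{f(\mathsf x+u)-f(\mathsf x-)-u\dot f(\mathsf x-)}{u^2}+\sup_{u\in(0,\delta]}\frac{f(\mathsf x+u)-f(\mathsf x+)-u\dot f(\mathsf x+)}{u^2}<\infty ;$$ and, for some (possibly different) $\delta>0$, the same holds for $G$ with a (measurable) derivative $g\ge0$ in place of $F$ and $f$. (b) With integrals over $(\mathcal X-\mathsf x)/h=\{u:\mathsf x+hu\in\mathcal X\}$, and $$\Gamma_h=\int_{\frac{\mathcal X-\mathsf x}{h}} R(u)R(u)'K(u)g(\mathsf x+hu)\,du,$$ $$\Sigma_h=\iint_{\frac{\mathcal X-\mathsf x}{h}} R(u)R(v)'\bigl[F(\mathsf x+h(u\wedge v))-F(\mathsf x+hu)F(\mathsf x+hv)\bigr]K(u)K(v)g(\mathsf x+hu)g(\mathsf x+hv)\,du\,dv,$$ the minimum eigenvalues of $\Gamma_h$ and of $h^{-1}\Sigma_h$ are bounded away from zero for all sufficiently small $h>0$. (c) $h=h_n>0$, $h\to0$, $nh\to\infty$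 and $n\varrho(h)^2/h\to0$ as $n\to\infty$. Write $$B_h^w=\int_{\frac{\mathcal X-\mathsf x}{h}}R(u)\bigl[F(\mathsf x+hu)-\theta'\Upsilon_h^{-1}R(u)\bigr]K(u)\,w(\mathsf x+hu)\,du,$$ $$W_{h,i}=\int_{\frac{\mathcal X-\mathsf x}{h}}R(u)\bigl[\mathbf 1(x_i\le\mathsf x+hu)-F(\mathsf x+hu)\bigr]K(u)\,g(\mathsf x+hu)\,du .$$ Then, for all sufficiently large $n$, $\hat\theta_G$ is uniquely determined and $$\hat\theta_G-\theta=\Upsilon_h\Gamma_h^{-1}B_h^g+\Upsilon_h\Gamma_h^{-1}\frac1n\sum_{i=1}^nW_{h,i},$$ and the following hold as $n\to\infty$. (i) (Bias) $|B_h^1|=O(\varrho(h))$ (weight $w\equiv1$) and $|B_h^g|=O(\varrho(h))$ (weight $w=g$). (ii) (Variance) For all sufficiently large $n$ and every $i$, $W_{h,i}$ is square integrable with covariance matrix $\mathbb V[W_{h,i}]=\Sigma_h$, and $$\Sigma_h^{-1/2}\,\frac1{\sqrt n}\sum_{i=1}^nW_{h,i}\rightsquigarrow\mathcal N(0,I_d).$$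 (iii) (Asymptotic normality) $$\sqrt n\,\bigl(\Gamma_h^{-1}\Sigma_h\Gamma_h^{-1}\bigr)^{-1/2}\Upsilon_h^{-1}(\hat\theta_G-\theta)\rightsquigarrow\mathcal N(0,I_d).$$ -/

import Mathlib

open MeasureTheory ProbabilityTheory Filter Topology Set
open scoped MatrixOrder

noncomputable section

namespace LocalL2

/-- `H` is absolutely continuous on a neighbourhood `[x₀ - δ, x₀ + δ]` with density `f ≥ 0` there
(written as: `f` is integrable and `H` is its indefinite integral), and `f` admits constants
`f(x₀-)`, `f(x₀+)`, `f'(x₀-)`, `f'(x₀+)` for which the two one-sided second-order suprema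
are finite. -/
def HasSmoothDensityNear (H f : ℝ → ℝ) (x₀ : ℝ) : Prop :=
  ∃ δ : ℝ, 0 < δ ∧
    IntervalIntegrable f volume (x₀ - δ) (x₀ + δ) ∧
    (∀ t ∈ Icc (x₀ - δ) (x₀ + δ), 0 ≤ f t) ∧
    (∀ a ∈ Icc (x₀ - δ) (x₀ + δ), ∀ b ∈ Icc (x₀ - δ) (x₀ + δ), H b - H a = ∫ t in a..b, f t) ∧
    ∃ fl fr dfl dfr : ℝ,
      BddAbove ((fun u : ℝ => (f (x₀ + u) - fl - u * dfl) / u ^ 2) '' Ico (-δ) 0) ∧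
      BddAbove ((fun u : ℝ => (f (x₀ + u) - fr - u * dfr) / u ^ 2) '' Ioc 0 δ)

/-- A kernel: nonnegative, symmetric, vanishing outside `[-1, 1]`, continuous on `[-1, 1]`
(jumps at `±1` are allowed), with integral one. -/
structure IsKernel (K : ℝ → ℝ) : Prop where
  nonneg : ∀ u, 0 ≤ K u
  symm : ∀ u, K (-u) = K u
  eq_zero : ∀ u, u ∉ Icc (-1 : ℝ) 1 → K u = 0
  continuousOn : ContinuousOn K (Icc (-1) 1)
  integral_eq_one : ∫ u, K u = 1

/-- A locally bounded basis `R`, with positive definite diagonal matrices `Υ h`, `h > 0`, such that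
`Υ h R(u) = R(u / h)`. -/
structure IsScalingBasis {d : ℕ} (R : ℝ → EuclideanSpace ℝ (Fin d))
    (Υ : ℝ → Matrix (Fin d) (Fin d) ℝ) : Prop where
  measurable : Measurable R
  locallyBounded : ∀ r : ℝ, ∃ C : ℝ, ∀ u ∈ Icc (-r) r, ‖R u‖ ≤ C
  isDiag : ∀ h : ℝ, 0 < h → (Υ h).IsDiag
  posDef : ∀ h : ℝ, 0 < h → (Υ h).PosDef
  scaling : ∀ h : ℝ, 0 < h → ∀ u : ℝ, Matrix.toEuclideanLin (Υ h) (R u) = R (u / h)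

/-- The rescaled support `(𝒳 - x₀) / h`, where `𝒳` is the support of the data distribution. -/
def scaledSupport (μ : Measure ℝ) (x₀ h : ℝ) : Set ℝ := {u | x₀ + h * u ∈ μ.support}

/-- The approximation error `ϱ(h) = sup_{|x - x₀| ≤ h} |F(x) - R(x - x₀)' θ|`. -/
def approxError {d : ℕ} (μ : Measure ℝ) (R : ℝ → EuclideanSpace ℝ (Fin d)) (x₀ : ℝ)
    (θ : EuclideanSpace ℝ (Fin d)) (h : ℝ) : ℝ :=
  sSup ((fun x : ℝ => |cdf μ x - inner ℝ (R (x - x₀)) θ|) '' Icc (x₀ - h) (x₀ + h))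

/-- The matrix `Γ_h`. -/
def Gam {d : ℕ} (μ : Measure ℝ) (R : ℝ → EuclideanSpace ℝ (Fin d)) (K g : ℝ → ℝ) (x₀ h : ℝ) :
    Matrix (Fin d) (Fin d) ℝ :=
  Matrix.of fun j k => ∫ u in scaledSupport μ x₀ h, R u j * R u k * K u * g (x₀ + h * u)

/-- The matrix `Σ_h`. -/
def Sig {d : ℕ} (μ : Measure ℝ) (R : ℝ → EuclideanSpace ℝ (Fin d)) (K g : ℝ → ℝ) (x₀ h : ℝ) :
    Matrix (Fin d) (Fin d) ℝ :=
  Matrix.of fun j k =>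
    ∫ u in scaledSupport μ x₀ h, ∫ v in scaledSupport μ x₀ h,
      R u j * R v k *
        (cdf μ (x₀ + h * min u v) - cdf μ (x₀ + h * u) * cdf μ (x₀ + h * v)) *
        K u * K v * g (x₀ + h * u) * g (x₀ + h * v)

/-- For all sufficiently small `h > 0`, the minimum eigenvalues of the (symmetric) matrices
`Γ_h` and `h⁻¹ Σ_h` are bounded away from zero. -/
def EigenvaluesBoundedBelow {d : ℕ} (μ : Measure ℝ) (R : ℝ → EuclideanSpace ℝ (Fin d))
    (K g : ℝ → ℝ) (x₀ : ℝ) : Prop :=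
  ∃ c : ℝ, 0 < c ∧ ∀ᶠ h in 𝓝[>] (0 : ℝ),
    (∀ ev ∈ spectrum ℝ (Gam μ R K g x₀ h), c ≤ ev) ∧
    (∀ ev ∈ spectrum ℝ (h⁻¹ • Sig μ R K g x₀ h), c ≤ ev)

/-- The empirical distribution function of the first `n` observations. -/
def empCdf {Ω : Type*} (X : ℕ → Ω → ℝ) (n : ℕ) (ω : Ω) (t : ℝ) : ℝ :=
  (n : ℝ)⁻¹ * ∑ i ∈ Finset.range n, (Iic t).indicator (fun _ => (1 : ℝ)) (X i ω)

/-- The local `L²` criterion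
`∫_𝒳 (F̂(u) - R(u - x₀)' t)² h⁻¹ K((u - x₀) / h) dG(u)`. -/
def criterion {d : ℕ} {Ω : Type*} (μ : Measure ℝ) (R : ℝ → EuclideanSpace ℝ (Fin d)) (K : ℝ → ℝ)
    (G : StieltjesFunction ℝ) (x₀ h : ℝ) (X : ℕ → Ω → ℝ) (n : ℕ) (ω : Ω)
    (t : EuclideanSpace ℝ (Fin d)) : ℝ :=
  ∫ u in μ.support,
    (empCdf X n ω u - inner ℝ (R (u - x₀)) t) ^ 2 * (h⁻¹ * K ((u - x₀) / h)) ∂G.measure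

/-- `t` minimizes the local `L²` criterion over `ℝ^d`. -/
def IsLocalL2Estimate {d : ℕ} {Ω : Type*} (μ : Measure ℝ) (R : ℝ → EuclideanSpace ℝ (Fin d))
    (K : ℝ → ℝ) (G : StieltjesFunction ℝ) (x₀ h : ℝ) (X : ℕ → Ω → ℝ) (n : ℕ) (ω : Ω)
    (t : EuclideanSpace ℝ (Fin d)) : Prop :=
  IsMinOn (criterion μ R K G x₀ h X n ω) univ t

/-- The integral in the bias term with design weight `w`:
`∫ R(u) [F(x₀ + h u) - θ' Υ_h⁻¹ R(u)] K(u) w(x₀ + h u) du` over `(𝒳 - x₀) / h`. -/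
def biasIntegral {d : ℕ} (μ : Measure ℝ) (R : ℝ → EuclideanSpace ℝ (Fin d))
    (Υ : ℝ → Matrix (Fin d) (Fin d) ℝ) (K w : ℝ → ℝ) (x₀ : ℝ) (θ : EuclideanSpace ℝ (Fin d))
    (h : ℝ) : EuclideanSpace ℝ (Fin d) :=
  ∫ u in scaledSupport μ x₀ h,
    ((cdf μ (x₀ + h * u) - inner ℝ (Matrix.toEuclideanLin (Υ h)⁻¹ (R u)) θ) *
      K u * w (x₀ + h * u)) • R u

/-- The integral in the linear variance term at the data point `x`:
`∫ R(u) [1(x ≤ x₀ + h u) - F(x₀ + h u)] K(u) g(x₀ + h u) du` over `(𝒳 - x₀) / h`. -/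
def influence {d : ℕ} (μ : Measure ℝ) (R : ℝ → EuclideanSpace ℝ (Fin d)) (K g : ℝ → ℝ)
    (x₀ h : ℝ) (x : ℝ) : EuclideanSpace ℝ (Fin d) :=
  ∫ u in scaledSupport μ x₀ h,
    (((Iic (x₀ + h * u)).indicator (fun _ => (1 : ℝ)) x - cdf μ (x₀ + h * u)) *
      K u * g (x₀ + h * u)) • R u

/-- `A^{-1/2}` for a positive definite matrix `A`: the inverse of its positive square root. -/
def invSqrt {d : ℕ} (A : Matrix (Fin d) (Fin d) ℝ) : Matrix (Fin d) (Fin d) ℝ := (CFC.sqrt A)⁻¹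

end LocalL2

end

/-!
Asymptotic normality of local `L²` distribution estimation.

For small `h` the change of variables `y = x₀ + h u` turns all the integrals of the problem into
integrals against one finite measure on `[-1, 1]`, the `designMeasure` `K(u) g(x₀ + h u) du` on the
rescaled support, whose mass is bounded uniformly in `h`. This only needs that `G` has the bounded
density `g` near `x₀` (`restrict_measure_eq_withDensity`); boundedness of `g` follows from the
finiteness of the one-sided suprema and `g ≥ 0` (`HasSmoothDensityNear.exists_bound`).

Since `R(h u) = Υ_h⁻¹ R(u)`, the criterion at `t` is the least squares criterion at `Υ_h⁻¹ t` for
the regressor `R` (`criterion_eq`). Completing the square (`integral_sq_sub_inner_eq`) and the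
positive definiteness of `Γ_h` give the unique minimizer `Υ_h Γ_h⁻¹ ∫ F̂ R`
(`isLocalL2Estimate_iff`). Writing `F̂ = R'θ + (F - R'θ) + (F̂ - F)` splits it into the target, the
bias integral and the mean of the influence function (`integral_empCdf_smul_eq`). The bias integral
is `O(ϱ(h))`, as its integrand is bounded by a multiple of `ϱ(h)`.

By Fubini the influence function is centred with covariance matrix `Σ_h`
(`covariance_influence`). If `A Σ_h Aᵀ = 1`, then `‖A w‖ ≤ (c h)^{-1/2} ‖w‖`, where `c h` bounds the
eigenvalues of `Σ_h` from below (`norm_le_of_mul_mul_transpose_eq_one`). The standardized summands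
are therefore bounded by a multiple of `h^{-1/2}`, that is, by `o(√n)` as `n h → ∞`, and a central
limit theorem for bounded triangular arrays applies
(`tendstoInDistribution_gaussian_of_bounded_array`), which is proved by expanding characteristic
functions and Lévy's continuity theorem. Both `A = Σ_h^{-1/2}` and
`A = (Γ_h⁻¹ Σ_h Γ_h⁻¹)^{-1/2} Γ_h⁻¹` are standardizations of this kind; for the latter, the bias
contributes a shift of size `O(√(n ϱ(h)² / h)) → 0`.
-/

namespace LocalL2

/-! ### A central limit theorem for bounded triangular arrays -/

/-- Third-order Taylor remainder of `x ↦ exp (i x)` at the origin. -/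
lemma norm_exp_I_mul_sub_le {x : ℝ} (hx : |x| ≤ 1) :
    ‖Complex.exp (x * Complex.I) - (1 + x * Complex.I - x ^ 2 / 2)‖ ≤ |x| ^ 3 := by
  have h1 : ‖(x * Complex.I : ℂ)‖ = |x| := by simp
  have := Complex.exp_bound (x := x * Complex.I) (by rw [h1]; exact hx) (n := 3) (by norm_num)
  rw [h1] at this
  have e : ∑ m ∈ Finset.range 3, (x * Complex.I : ℂ) ^ m / m.factorial
      = 1 + x * Complex.I - x ^ 2 / 2 := by
    simp [Finset.sum_range_succ, mul_pow, Nat.factorial]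
    ring
  rw [e] at this
  refine this.trans ?_
  have : (0 : ℝ) ≤ |x| ^ 3 := by positivity
  norm_num [Nat.factorial]
  linarith

/-- Second-order expansion of the characteristic function of a bounded centred variable; the
third moment is controlled by the bound times the variance. -/
lemma norm_charFun_sub_le {α : Type*} [MeasurableSpace α] {μ : Measure α} [IsProbabilityMeasure μ]
    {Z : α → ℝ} (hZ : Measurable Z) {b v s : ℝ} (hb : ∀ x, |Z x| ≤ b)
    (h0 : ∫ x, Z x ∂μ = 0) (h2 : ∫ x, Z x ^ 2 ∂μ = v) (hs : 0 ≤ s) (hsb : s * b ≤ 1) :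
    ‖charFun (μ.map Z) s - (1 - ((s ^ 2 * v / 2 : ℝ) : ℂ))‖ ≤ s * b * (s ^ 2 * v) := by
  have bddInt : ∀ {f : α → ℝ}, Measurable f → (∃ C, ∀ x, |f x| ≤ C) → Integrable f μ := by
    rintro f hf ⟨C, hC⟩
    exact Integrable.of_bound hf.aestronglyMeasurable C (.of_forall hC)
  have iZ : Integrable Z μ := bddInt hZ ⟨b, hb⟩
  have iZ2 : Integrable (fun x => Z x ^ 2) μ := by
    refine bddInt (hZ.pow_const 2) ⟨b ^ 2, fun x => ?_⟩
    rw [abs_pow]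
    exact pow_le_pow_left₀ (abs_nonneg _) (hb x) 2
  have iE : Integrable (fun x => Complex.exp ((s * Z x : ℝ) * Complex.I)) μ := by
    refine Integrable.of_bound (by fun_prop) 1 (.of_forall fun x => ?_)
    rw [Complex.norm_exp_ofReal_mul_I]
  have iP : Integrable
      (fun x => (1 + (s * Z x : ℝ) * Complex.I - ((s * Z x : ℝ) : ℂ) ^ 2 / 2)) μ := by
    refine ((integrable_const _).add ((iZ.const_mul s).ofReal.mul_const _)).sub ?_
    have := ((iZ2.const_mul (s ^ 2 / 2)).ofReal (𝕜 := ℂ))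
    refine this.congr (.of_forall fun x => ?_)
    simp
    ring
  have eP : ∫ x, (1 + (s * Z x : ℝ) * Complex.I - ((s * Z x : ℝ) : ℂ) ^ 2 / 2) ∂μ
      = 1 - ((s ^ 2 * v / 2 : ℝ) : ℂ) := by
    have i1 : Integrable (fun x => ((s * Z x : ℝ) : ℂ) * Complex.I) μ :=
      (iZ.const_mul s).ofReal.mul_const _
    have e2 : (fun x => ((s * Z x : ℝ) : ℂ) ^ 2 / 2) =
        fun x => ((s ^ 2 / 2 * Z x ^ 2 : ℝ) : ℂ) := by
      ext x; push_cast; ring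
    have i2 : Integrable (fun x => ((s * Z x : ℝ) : ℂ) ^ 2 / 2) μ := by
      rw [e2]; exact (iZ2.const_mul (s ^ 2 / 2)).ofReal
    have i12 : Integrable (fun x => 1 + ((s * Z x : ℝ) : ℂ) * Complex.I) μ :=
      (integrable_const _).add i1
    rw [integral_sub i12 i2, integral_add (integrable_const _) i1,
      integral_mul_const, integral_complex_ofReal, integral_const_mul, h0, e2,
      integral_complex_ofReal, integral_const_mul, h2]
    simp
    ring
  rw [charFun_apply_real, integral_map hZ.aemeasurable (by fun_prop), ← eP]
  have : ∀ x, Complex.exp (s * Z x * Complex.I) = Complex.exp ((s * Z x : ℝ) * Complex.I) := by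
    intro x; push_cast; rfl
  simp_rw [this]
  rw [← integral_sub iE iP]
  have i3 : Integrable (fun x => s * b * (s ^ 2 * Z x ^ 2)) μ := (iZ2.const_mul _).const_mul _
  have := norm_integral_le_of_norm_le (f := fun x => Complex.exp ((s * Z x : ℝ) * Complex.I) -
    (1 + (s * Z x : ℝ) * Complex.I - ((s * Z x : ℝ) : ℂ) ^ 2 / 2)) i3 (.of_forall fun x => ?_)
  · rwa [integral_const_mul, integral_const_mul, h2] at this
  · have hx : |s * Z x| ≤ s * b := by
      rw [abs_mul, abs_of_nonneg hs]
      exact mul_le_mul_of_nonneg_left (hb x) hs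
    refine (norm_exp_I_mul_sub_le (hx.trans hsb)).trans ?_
    have : |s * Z x| ^ 3 = |s * Z x| * (s ^ 2 * Z x ^ 2) := by
      rw [pow_succ', sq_abs]; ring
    rw [this]
    exact mul_le_mul_of_nonneg_right hx (by positivity)

/-- The `n`-th powers of the characteristic functions of the summands of a bounded triangular
array converge to the characteristic function of a Gaussian. -/
lemma tendsto_charFun_pow {α : Type*} [MeasurableSpace α] {μ : Measure α} [IsProbabilityMeasure μ]
    {Z : ℕ → α → ℝ} (hZ : ∀ n, Measurable (Z n)) {b : ℕ → ℝ} {v : ℝ}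
    (hb : ∀ᶠ n in atTop, ∀ x, |Z n x| ≤ b n)
    (hb0 : Tendsto (fun n : ℕ => (√(n : ℝ))⁻¹ * b n) atTop (𝓝 0))
    (h0 : ∀ᶠ n in atTop, ∫ x, Z n x ∂μ = 0) (h2 : ∀ᶠ n in atTop, ∫ x, Z n x ^ 2 ∂μ = v) :
    Tendsto (fun n : ℕ => charFun (μ.map (Z n)) (√(n : ℝ))⁻¹ ^ n) atTop
      (𝓝 (Complex.exp (-v / 2))) := by
  apply Complex.tendsto_pow_exp_of_isLittleO_sub_add_div
  rw [Asymptotics.isLittleO_iff]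
  intro ε hε
  have hsmall : ∀ᶠ n : ℕ in atTop, (√(n : ℝ))⁻¹ * b n * |v| ≤ ε := by
    have : Tendsto (fun n : ℕ => (√(n : ℝ))⁻¹ * b n * |v|) atTop (𝓝 0) := by
      simpa using hb0.mul_const |v|
    exact this.eventually (eventually_le_nhds hε)
  filter_upwards [hb, h0, h2, hb0.eventually (eventually_le_nhds one_pos), hsmall,
    eventually_gt_atTop 0] with n hbn h0n h2n h1n hεn hn
  have hsq : (√(n : ℝ))⁻¹ ^ 2 = 1 / n := by
    rw [inv_pow, Real.sq_sqrt (Nat.cast_nonneg n), one_div]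
  have := norm_charFun_sub_le (hZ n) hbn h0n h2n (inv_nonneg.2 (Real.sqrt_nonneg n)) h1n
  rw [hsq] at this
  have hv : 0 ≤ v := by rw [← h2n]; exact integral_nonneg fun x => sq_nonneg _
  rw [abs_of_nonneg hv] at hεn
  have e : charFun (μ.map (Z n)) (√(n : ℝ))⁻¹ - (1 - ((1 / n * v / 2 : ℝ) : ℂ))
      = charFun (μ.map (Z n)) (√(n : ℝ))⁻¹ - (1 + -v / 2 / n) := by
    push_cast; ring
  rw [e] at this
  refine this.trans ?_
  have hn' : ‖(1 / (n : ℂ))‖ = 1 / (n : ℝ) := by simp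
  rw [hn']
  calc _ = ((√(n : ℝ))⁻¹ * b n * v) * (1 / n) := by ring
    _ ≤ ε * (1 / n) := by gcongr

section Array

variable {E : Type*} [NormedAddCommGroup E] [InnerProductSpace ℝ E] [FiniteDimensional ℝ E]
  [MeasurableSpace E] [BorelSpace E]

/-- Lindeberg–Feller for rows of i.i.d. vectors `W n (X i)`, `i < n`, that are centred, have
identity covariance and are uniformly bounded by `o(√n)`; a vanishing deterministic shift is
allowed. The moments are stated through the scalar products with a fixed vector, and the standard
Gaussian limit law through its characteristic function. -/
theorem tendstoInDistribution_gaussian_of_bounded_array {Ω : Type*} [MeasurableSpace Ω]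
    {P : Measure Ω} [IsProbabilityMeasure P] {α : Type*} [MeasurableSpace α] {μ : Measure α}
    [IsProbabilityMeasure μ] {X : ℕ → Ω → α} (hXmeas : ∀ i, Measurable (X i))
    (hXindep : iIndepFun X P) (hXlaw : ∀ i, P.map (X i) = μ)
    {T : ℕ → Ω → E} (hT : ∀ n, AEMeasurable (T n) P) {W : ℕ → α → E} (hW : ∀ n, Measurable (W n))
    {b : ℕ → E} (hb : Tendsto b atTop (𝓝 0)) {c : ℕ → ℝ}
    (hTW : ∀ᶠ n : ℕ in atTop, ∀ ω,
      T n ω = b n + (√(n : ℝ))⁻¹ • ∑ i ∈ Finset.range n, W n (X i ω))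
    (hc : ∀ᶠ n in atTop, ∀ x, ‖W n x‖ ≤ c n)
    (hc0 : Tendsto (fun n : ℕ => (√(n : ℝ))⁻¹ * c n) atTop (𝓝 0))
    (h0 : ∀ t : E, ∀ᶠ n in atTop, ∫ x, inner ℝ (W n x) t ∂μ = 0)
    (h2 : ∀ t : E, ∀ᶠ n in atTop, ∫ x, inner ℝ (W n x) t ^ 2 ∂μ = ‖t‖ ^ 2)
    {ν : Measure E} [IsProbabilityMeasure ν]
    (hν : ∀ t : E, charFun ν t = Complex.exp (-‖t‖ ^ 2 / 2)) :
    TendstoInDistribution T atTop (id : E → E) (fun _ => P) ν where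
  forall_aemeasurable := hT
  aemeasurable_limit := by fun_prop
  tendsto := by
    refine ProbabilityMeasure.tendsto_iff_tendsto_charFun.2 fun t ↦ ?_
    simp only [ProbabilityMeasure.coe_mk, Measure.map_id, hν]
    have hZ : ∀ n, Measurable fun x => inner ℝ (W n x) t := fun n => (hW n).inner_const
    have key := tendsto_charFun_pow (μ := μ) (Z := fun n x => inner ℝ (W n x) t)
      (b := fun n => c n * ‖t‖) (v := ‖t‖ ^ 2) hZ
      (by
        filter_upwards [hc] with n hn x
        exact (abs_real_inner_le_norm _ _).trans (by gcongr; exact hn x))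
      (by simpa [mul_assoc] using hc0.mul_const ‖t‖) (h0 t) (h2 t)
    have hshift : Tendsto (fun n => Complex.exp (inner ℝ (b n) t * Complex.I)) atTop (𝓝 1) := by
      have : Tendsto (fun n => inner ℝ (b n) t) atTop (𝓝 0) := by
        simpa using hb.inner (tendsto_const_nhds (x := t))
      have h3 := ((Complex.continuous_ofReal.tendsto 0).comp this).mul_const Complex.I
      simpa [Function.comp_def] using (Complex.continuous_exp.tendsto _).comp h3
    have := hshift.mul key
    simp only [one_mul] at this
    push_cast at this
    refine this.congr' ?_
    filter_upwards [hTW] with n hn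
    have hind : iIndepFun (fun i ω => inner ℝ (W n (X i ω)) t) P :=
      hXindep.comp (fun _ x => inner ℝ (W n x) t) fun _ => hZ n
    have hmeas : ∀ i, Measurable fun ω => inner ℝ (W n (X i ω)) t := fun i => (hZ n).comp (hXmeas i)
    have hlaw : ∀ i, P.map (fun ω => inner ℝ (W n (X i ω)) t) =
        μ.map (fun x => inner ℝ (W n x) t) := by
      intro i
      rw [← hXlaw i, Measure.map_map (hZ n) (hXmeas i)]
      rfl
    have hprod := (hind.restrict (Finset.range n)).charFun_map_fun_finsetSum_eq_prod
      (fun i _ => (hmeas i).aemeasurable)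
    have hpow : charFun (μ.map fun x => inner ℝ (W n x) t) (√(n : ℝ))⁻¹ ^ n =
        charFun (P.map fun ω => ∑ i ∈ Finset.range n, inner ℝ (W n (X i ω)) t) (√(n : ℝ))⁻¹ := by
      rw [hprod]
      simp [hlaw]
    rw [hpow, charFun_apply_real, integral_map (Finset.measurable_fun_sum _ fun i _ =>
      hmeas i).aemeasurable (by fun_prop), ← integral_const_mul, charFun_apply,
      integral_map (hT n) (by fun_prop)]
    refine integral_congr_ae (.of_forall fun ω => ?_)
    simp only [hn ω, inner_add_left, real_inner_smul_left, sum_inner, ← Complex.exp_add]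
    push_cast
    congr 1
    ring

end Array

/-! ### Positive definite matrices as operators on Euclidean space -/

section Matrices

variable {d : ℕ}

lemma inner_toEuclideanLin_eq_sum (A : Matrix (Fin d) (Fin d) ℝ) (s t : EuclideanSpace ℝ (Fin d)) :
    inner ℝ s (Matrix.toEuclideanLin A t) = ∑ j, ∑ k, s j * A j k * t k := by
  simp only [PiLp.inner_apply, Matrix.ofLp_toLpLin, Matrix.toLin'_apply, Matrix.mulVec,
    dotProduct, RCLike.inner_apply, conj_trivial, Finset.sum_mul]
  refine Finset.sum_congr rfl fun j _ => Finset.sum_congr rfl fun k _ => by ring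

lemma inner_toEuclideanLin_transpose (A : Matrix (Fin d) (Fin d) ℝ)
    (s t : EuclideanSpace ℝ (Fin d)) :
    inner ℝ (Matrix.toEuclideanLin A s) t = inner ℝ s (Matrix.toEuclideanLin A.transpose t) := by
  rw [real_inner_comm, inner_toEuclideanLin_eq_sum, inner_toEuclideanLin_eq_sum, Finset.sum_comm]
  refine Finset.sum_congr rfl fun j _ => Finset.sum_congr rfl fun k _ => ?_
  rw [Matrix.transpose_apply]; ring

lemma toEuclideanLin_mul_apply (A B : Matrix (Fin d) (Fin d) ℝ) (s : EuclideanSpace ℝ (Fin d)) :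
    Matrix.toEuclideanLin (A * B) s = Matrix.toEuclideanLin A (Matrix.toEuclideanLin B s) := by
  ext i
  simp

lemma toEuclideanLin_one_apply (s : EuclideanSpace ℝ (Fin d)) :
    Matrix.toEuclideanLin (1 : Matrix (Fin d) (Fin d) ℝ) s = s := by
  ext i
  simp

/-- A lower bound for the spectrum of a symmetric matrix bounds its quadratic form. -/
lemma mul_norm_sq_le_inner_of_le_spectrum {A : Matrix (Fin d) (Fin d) ℝ} (hA : A.IsHermitian)
    {c : ℝ} (hc : ∀ ev ∈ spectrum ℝ A, c ≤ ev) (s : EuclideanSpace ℝ (Fin d)) :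
    c * ‖s‖ ^ 2 ≤ inner ℝ s (Matrix.toEuclideanLin A s) := by
  have h := (algebraMap_le_iff_le_spectrum (a := A) (r := c) hA).2 hc
  have h' := (Matrix.le_iff.1 h).dotProduct_mulVec_nonneg (WithLp.ofLp s)
  have e : (star (WithLp.ofLp s) ⬝ᵥ (A - algebraMap ℝ _ c).mulVec (WithLp.ofLp s)) =
      inner ℝ s (Matrix.toEuclideanLin A s) - c * ‖s‖ ^ 2 := by
    rw [← real_inner_self_eq_norm_sq, Matrix.sub_mulVec, dotProduct_sub,
      Algebra.algebraMap_eq_smul_one, Matrix.smul_mulVec, Matrix.one_mulVec, dotProduct_smul, smul_eq_mul]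
    congr 1
    · rw [EuclideanSpace.inner_eq_star_dotProduct]
      simp [dotProduct_comm]
  rw [e] at h'
  linarith

lemma posDef_of_mul_norm_sq_le_inner {A : Matrix (Fin d) (Fin d) ℝ} (hA : A.IsHermitian)
    {c : ℝ} (hc0 : 0 < c)
    (hc : ∀ s : EuclideanSpace ℝ (Fin d), c * ‖s‖ ^ 2 ≤ inner ℝ s (Matrix.toEuclideanLin A s)) :
    A.PosDef := by
  refine Matrix.PosDef.of_dotProduct_mulVec_pos hA fun x hx => ?_
  have hx' : WithLp.toLp 2 x ≠ 0 := by simpa using hx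
  have h1 := hc (WithLp.toLp 2 x)
  have h2 : 0 < c * ‖WithLp.toLp 2 x‖ ^ 2 := by positivity
  rw [EuclideanSpace.inner_eq_star_dotProduct, dotProduct_comm] at h1
  simp only [Matrix.ofLp_toLpLin, Matrix.toLin'_apply] at h1
  linarith

lemma invSqrt_mul_mul_transpose {S : Matrix (Fin d) (Fin d) ℝ} (hS : S.PosDef) :
    invSqrt S * S * (invSqrt S).transpose = 1 := by
  have hnn : (0 : Matrix (Fin d) (Fin d) ℝ) ≤ S := Matrix.nonneg_iff_posSemidef.2 hS.posSemidef
  have hsq : CFC.sqrt S * CFC.sqrt S = S := CFC.sqrt_mul_sqrt_self S hnn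
  have hT : (CFC.sqrt S).transpose = CFC.sqrt S := by
    have := (Matrix.nonneg_iff_posSemidef.1 (CFC.sqrt_nonneg S)).isHermitian
    simpa [Matrix.IsHermitian, Matrix.conjTranspose_eq_transpose_of_trivial] using this
  have hdet : IsUnit (CFC.sqrt S).det := by
    have h1 : (CFC.sqrt S).det * (CFC.sqrt S).det = S.det := by rw [← Matrix.det_mul, hsq]
    have h2 := hS.det_pos
    rw [isUnit_iff_ne_zero]
    rintro h
    rw [h] at h1
    simp at h1
    linarith
  unfold invSqrt
  rw [Matrix.transpose_nonsing_inv, hT]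
  nth_rewrite 2 [← hsq]
  rw [Matrix.nonsing_inv_mul_cancel_left _ _ hdet, Matrix.mul_nonsing_inv _ hdet]

/-- `(Γ⁻¹ Σ Γ⁻¹)^{-1/2} Γ⁻¹` is another standardization of a vector with covariance `Σ`. -/
lemma invSqrt_sandwich_mul_mul_transpose {S Γ : Matrix (Fin d) (Fin d) ℝ} (hS : S.PosDef)
    (hΓ : Γ.PosDef) :
    (invSqrt (Γ⁻¹ * S * Γ⁻¹) * Γ⁻¹) * S * (invSqrt (Γ⁻¹ * S * Γ⁻¹) * Γ⁻¹).transpose = 1 := by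
  have hT : Γ⁻¹.transpose = Γ⁻¹ := by
    have := hΓ.inv.isHermitian
    simpa [Matrix.IsHermitian, Matrix.conjTranspose_eq_transpose_of_trivial] using this
  have hpd : (Γ⁻¹ * S * Γ⁻¹).PosDef := by
    have := hS.conjTranspose_mul_mul_same (B := Γ⁻¹)
      (Matrix.mulVec_injective_of_isUnit hΓ.inv.isUnit)
    rwa [Matrix.conjTranspose_eq_transpose_of_trivial, hT] at this
  have := invSqrt_mul_mul_transpose hpd
  rw [Matrix.transpose_mul, hT]
  simpa [Matrix.mul_assoc] using this

lemma norm_sq_eq_of_mul_mul_transpose_eq_one {A S : Matrix (Fin d) (Fin d) ℝ}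
    (hA : A * S * A.transpose = 1) (t : EuclideanSpace ℝ (Fin d)) :
    inner ℝ (Matrix.toEuclideanLin A.transpose t)
      (Matrix.toEuclideanLin S (Matrix.toEuclideanLin A.transpose t)) = ‖t‖ ^ 2 := by
  rw [inner_toEuclideanLin_transpose, Matrix.transpose_transpose, ← toEuclideanLin_mul_apply,
    ← toEuclideanLin_mul_apply, hA, toEuclideanLin_one_apply,
    real_inner_self_eq_norm_sq]

/-- Any `A` that standardizes `S` has norm at most the inverse square root of a lower bound for
the eigenvalues of `S`. -/
lemma norm_le_of_mul_mul_transpose_eq_one {A S : Matrix (Fin d) (Fin d) ℝ}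
    (hA : A * S * A.transpose = 1) {c : ℝ} (hc0 : 0 < c)
    (hc : ∀ s : EuclideanSpace ℝ (Fin d), c * ‖s‖ ^ 2 ≤ inner ℝ s (Matrix.toEuclideanLin S s))
    (w : EuclideanSpace ℝ (Fin d)) :
    ‖Matrix.toEuclideanLin A w‖ ≤ (√c)⁻¹ * ‖w‖ := by
  -- duality: bound `‖A w‖ ^ 2 = ⟪w, Aᵀ (A w)⟫` through the isometry property of `S^{1/2} Aᵀ`
  set t := Matrix.toEuclideanLin A w
  have h1 : ‖t‖ ^ 2 ≤ ‖w‖ * ‖Matrix.toEuclideanLin A.transpose t‖ := by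
    rw [← real_inner_self_eq_norm_sq]
    nth_rewrite 1 [show t = Matrix.toEuclideanLin A w from rfl]
    rw [inner_toEuclideanLin_transpose]
    exact real_inner_le_norm _ _
  have h2 : √c * ‖Matrix.toEuclideanLin A.transpose t‖ ≤ ‖t‖ := by
    refine abs_le_of_sq_le_sq' ?_ (norm_nonneg t) |>.2
    rw [mul_pow, Real.sq_sqrt hc0.le, ← norm_sq_eq_of_mul_mul_transpose_eq_one hA t]
    exact hc _
  have hs : 0 < √c := Real.sqrt_pos.2 hc0
  rw [inv_mul_eq_div, le_div_iff₀ hs]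
  rcases (norm_nonneg t).eq_or_lt with h0 | h0
  · rw [← h0]; simp
  · refine le_of_mul_le_mul_right ?_ h0
    nlinarith [norm_nonneg w]

/-- A matrix of second moments represents the second moment of the linear forms. -/
lemma inner_toEuclideanLin_of_integral_mul {α : Type*} [MeasurableSpace α] {ν : Measure α}
    {V : α → EuclideanSpace ℝ (Fin d)} {S : Matrix (Fin d) (Fin d) ℝ}
    (hint : ∀ j k, Integrable (fun x => V x j * V x k) ν)
    (hS : ∀ j k, S j k = ∫ x, V x j * V x k ∂ν) (s t : EuclideanSpace ℝ (Fin d)) :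
    inner ℝ s (Matrix.toEuclideanLin S t) = ∫ x, inner ℝ (V x) s * inner ℝ (V x) t ∂ν := by
  rw [inner_toEuclideanLin_eq_sum]
  have : ∀ x, inner ℝ (V x) s * inner ℝ (V x) t =
      ∑ j, ∑ k, s j * t k * (V x j * V x k) := by
    intro x
    simp only [PiLp.inner_apply, RCLike.inner_apply, conj_trivial, Finset.sum_mul_sum]
    refine Finset.sum_congr rfl fun j _ => Finset.sum_congr rfl fun k _ => by ring
  simp_rw [this]
  rw [integral_finsetSum _ fun j _ => integrable_finsetSum _ fun k _ => (hint j k).const_mul _]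
  refine Finset.sum_congr rfl fun j _ => ?_
  rw [integral_finsetSum _ fun k _ => (hint j k).const_mul _]
  refine Finset.sum_congr rfl fun k _ => ?_
  rw [integral_const_mul, hS]
  ring

lemma isHermitian_of_integral_mul {α : Type*} [MeasurableSpace α] {ν : Measure α}
    {V : α → EuclideanSpace ℝ (Fin d)} {S : Matrix (Fin d) (Fin d) ℝ}
    (hS : ∀ j k, S j k = ∫ x, V x j * V x k ∂ν) : S.IsHermitian := by
  ext j k
  simp [hS, mul_comm]

end Matrices

/-! ### Weighted least squares -/

section LeastSquares

variable {d : ℕ} {α : Type*} [MeasurableSpace α] {ν : Measure α}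

lemma inner_integral_smul {V : α → EuclideanSpace ℝ (Fin d)} {Y : α → ℝ}
    (h : Integrable (fun x => Y x • V x) ν) (s : EuclideanSpace ℝ (Fin d)) :
    inner ℝ (∫ x, Y x • V x ∂ν) s = ∫ x, Y x * inner ℝ (V x) s ∂ν := by
  rw [real_inner_comm, ← integral_inner h s]
  refine integral_congr_ae (.of_forall fun x => ?_)
  simp only [real_inner_smul_right, real_inner_comm]

lemma ae_abs_inner_le {V : α → EuclideanSpace ℝ (Fin d)} {C : ℝ}
    (hC : ∀ᵐ u ∂ν, ‖V u‖ ≤ C) (s : EuclideanSpace ℝ (Fin d)) :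
    ∀ᵐ u ∂ν, |inner ℝ (V u) s| ≤ C * ‖s‖ := by
  filter_upwards [hC] with u hu
  exact (abs_real_inner_le_norm _ _).trans (by gcongr)

variable [IsFiniteMeasure ν]

lemma integrable_of_measurable_of_le {f : α → ℝ} (hf : Measurable f) {C : ℝ}
    (hC : ∀ᵐ x ∂ν, |f x| ≤ C) : Integrable f ν :=
  Integrable.of_bound hf.aestronglyMeasurable C hC

lemma measurable_coord {V : α → EuclideanSpace ℝ (Fin d)} (hV : Measurable V) (j : Fin d) :
    Measurable fun x => V x j :=
  (EuclideanSpace.proj (𝕜 := ℝ) j).continuous.measurable.comp hV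

lemma abs_coord_le (v : EuclideanSpace ℝ (Fin d)) (j : Fin d) : |v j| ≤ ‖v‖ :=
  PiLp.norm_apply_le v j

lemma integrable_coord_mul_coord {V : α → EuclideanSpace ℝ (Fin d)} (hV : Measurable V) {C : ℝ}
    (hC : ∀ᵐ x ∂ν, ‖V x‖ ≤ C) (j k : Fin d) : Integrable (fun x => V x j * V x k) ν := by
  refine integrable_of_measurable_of_le (C := C * C)
    ((measurable_coord hV j).mul (measurable_coord hV k)) ?_
  filter_upwards [hC] with x hx
  rw [abs_mul]
  exact mul_le_mul ((abs_coord_le _ _).trans hx) ((abs_coord_le _ _).trans hx) (abs_nonneg _)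
    ((norm_nonneg _).trans hx)

lemma integrable_smul_of_bounded {V : α → EuclideanSpace ℝ (Fin d)} (hV : Measurable V) {C : ℝ}
    (hC : ∀ᵐ x ∂ν, ‖V x‖ ≤ C) {Y : α → ℝ} (hY : Measurable Y) {D : ℝ}
    (hD : ∀ᵐ x ∂ν, |Y x| ≤ D) : Integrable (fun x => Y x • V x) ν := by
  refine Integrable.of_bound (hY.smul hV).aestronglyMeasurable (D * C) ?_
  filter_upwards [hC, hD] with x hx hy
  rw [norm_smul]
  exact mul_le_mul hy hx (norm_nonneg _) ((abs_nonneg _).trans hy)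

lemma toEuclideanLin_eq_integral_smul {V : α → EuclideanSpace ℝ (Fin d)} (hV : Measurable V)
    {C : ℝ} (hC : ∀ᵐ x ∂ν, ‖V x‖ ≤ C) {Γ : Matrix (Fin d) (Fin d) ℝ}
    (hΓ : ∀ j k, Γ j k = ∫ x, V x j * V x k ∂ν) (s : EuclideanSpace ℝ (Fin d)) :
    Matrix.toEuclideanLin Γ s = ∫ x, inner ℝ (V x) s • V x ∂ν := by
  refine ext_inner_left ℝ fun v => ?_
  rw [inner_toEuclideanLin_of_integral_mul (integrable_coord_mul_coord hV hC) hΓ,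
    real_inner_comm, inner_integral_smul
      (integrable_smul_of_bounded hV hC hV.inner_const (ae_abs_inner_le hC s))]
  refine integral_congr_ae (.of_forall fun x => ?_)
  simp only
  ring

/-- Completing the square around the solution `Γ⁻¹ ∫ Y V` of the normal equations. -/
lemma integral_sq_sub_inner_eq {V : α → EuclideanSpace ℝ (Fin d)} (hV : Measurable V) {C : ℝ}
    (hC : ∀ᵐ x ∂ν, ‖V x‖ ≤ C) {Y : α → ℝ} (hY : Measurable Y) {D : ℝ}
    (hD : ∀ᵐ x ∂ν, |Y x| ≤ D) {Γ : Matrix (Fin d) (Fin d) ℝ}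
    (hΓ : ∀ j k, Γ j k = ∫ x, V x j * V x k ∂ν) (hpd : Γ.PosDef)
    (s : EuclideanSpace ℝ (Fin d)) :
    ∫ x, (Y x - inner ℝ (V x) s) ^ 2 ∂ν =
      ∫ x, (Y x - inner ℝ (V x) (Matrix.toEuclideanLin Γ⁻¹ (∫ x, Y x • V x ∂ν))) ^ 2 ∂ν +
      inner ℝ (s - Matrix.toEuclideanLin Γ⁻¹ (∫ x, Y x • V x ∂ν))
        (Matrix.toEuclideanLin Γ (s - Matrix.toEuclideanLin Γ⁻¹ (∫ x, Y x • V x ∂ν))) := by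
  set β := Matrix.toEuclideanLin Γ⁻¹ (∫ x, Y x • V x ∂ν) with hβ
  have hint := integrable_coord_mul_coord hV hC
  have hin : ∀ t, Measurable fun x => inner ℝ (V x) t := fun t => hV.inner_const
  have hinb : ∀ t, ∀ᵐ x ∂ν, |inner ℝ (V x) t| ≤ C * ‖t‖ := by
    intro t
    filter_upwards [hC] with x hx
    exact (abs_real_inner_le_norm _ _).trans (by gcongr)
  have iVV : ∀ t u, Integrable (fun x => inner ℝ (V x) t * inner ℝ (V x) u) ν := by
    intro t u
    refine integrable_of_measurable_of_le (C := (C * ‖t‖) * (C * ‖u‖)) ((hin t).mul (hin u)) ?_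
    filter_upwards [hinb t, hinb u] with x h1 h2
    rw [abs_mul]
    exact mul_le_mul h1 h2 (abs_nonneg _) ((abs_nonneg _).trans h1)
  have iYV : ∀ t, Integrable (fun x => Y x * inner ℝ (V x) t) ν := by
    intro t
    refine integrable_of_measurable_of_le (C := D * (C * ‖t‖)) (hY.mul (hin t)) ?_
    filter_upwards [hD, hinb t] with x h1 h2
    rw [abs_mul]
    exact mul_le_mul h1 h2 (abs_nonneg _) ((abs_nonneg _).trans h1)
  have iQ : Integrable (fun x => (Y x - inner ℝ (V x) β) ^ 2) ν := by
    refine integrable_of_measurable_of_le (C := (D + C * ‖β‖) ^ 2)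
      ((hY.sub (hin β)).pow_const 2) ?_
    filter_upwards [hD, hinb β] with x h1 h2
    rw [abs_pow]
    exact pow_le_pow_left₀ (abs_nonneg _) ((abs_sub _ _).trans (add_le_add h1 h2)) 2
  -- the normal equations
  have hnormal : ∀ t, ∫ x, (Y x - inner ℝ (V x) β) * inner ℝ (V x) t ∂ν = 0 := by
    intro t
    simp_rw [sub_mul]
    rw [integral_sub (iYV t) (iVV β t), ← inner_integral_smul
      (integrable_smul_of_bounded hV hC hY hD) t]
    have := inner_toEuclideanLin_of_integral_mul hint hΓ t β
    simp_rw [mul_comm (inner ℝ (V _) β)]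
    rw [← this, hβ, ← toEuclideanLin_mul_apply,
      Matrix.mul_nonsing_inv _ ((Matrix.isUnit_iff_isUnit_det _).1 hpd.isUnit),
      toEuclideanLin_one_apply, real_inner_comm, sub_self]
  rw [inner_toEuclideanLin_of_integral_mul hint hΓ]
  have iR : Integrable (fun x => 2 * ((Y x - inner ℝ (V x) β) * inner ℝ (V x) (s - β))) ν := by
    simp_rw [sub_mul]
    exact ((iYV _).sub (iVV _ _)).const_mul 2
  have e : ∀ x, (Y x - inner ℝ (V x) s) ^ 2 = ((Y x - inner ℝ (V x) β) ^ 2 -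
      2 * ((Y x - inner ℝ (V x) β) * inner ℝ (V x) (s - β))) +
      inner ℝ (V x) (s - β) * inner ℝ (V x) (s - β) := by
    intro x
    rw [inner_sub_right]
    ring
  have iQR : Integrable (fun x => (Y x - inner ℝ (V x) β) ^ 2 -
      2 * ((Y x - inner ℝ (V x) β) * inner ℝ (V x) (s - β))) ν := iQ.sub iR
  simp_rw [e]
  rw [integral_add iQR (iVV _ _), integral_sub iQ iR, integral_const_mul, hnormal]
  simp

end LeastSquares

/-! ### Integrals of the empirical process -/

section EmpiricalProcess

variable {d : ℕ} {μ : Measure ℝ}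

/-- The centred indicator `1(x ≤ a) - F(a)`. -/
noncomputable def centredIndicator (μ : Measure ℝ) (a x : ℝ) : ℝ :=
  (Iic a).indicator (fun _ => (1 : ℝ)) x - cdf μ a

lemma abs_centredIndicator_le (a x : ℝ) : |centredIndicator μ a x| ≤ 1 := by
  have h0 := cdf_nonneg μ a
  have h1 := cdf_le_one μ a
  unfold centredIndicator
  by_cases h : x ∈ Iic a <;> simp [h, abs_le] <;> constructor <;> linarith

lemma measurable_indicator_Iic : Measurable fun p : ℝ × ℝ =>
    (Iic p.1).indicator (fun _ => (1 : ℝ)) p.2 := by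
  have : (fun p : ℝ × ℝ => (Iic p.1).indicator (fun _ => (1 : ℝ)) p.2) =
      {p : ℝ × ℝ | p.2 ≤ p.1}.indicator fun _ => (1 : ℝ) := by
    ext p
    simp [indicator]
  rw [this]
  exact measurable_const.indicator (measurableSet_le measurable_snd measurable_fst)

lemma measurable_centredIndicator :
    Measurable fun p : ℝ × ℝ => centredIndicator μ p.1 p.2 :=
  measurable_indicator_Iic.sub ((monotone_cdf μ).measurable.comp measurable_fst)

variable {ν : Measure ℝ} [IsFiniteMeasure ν] {a : ℝ → ℝ}
  {V : ℝ → EuclideanSpace ℝ (Fin d)} {C : ℝ}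

lemma integrable_centredIndicator_smul (ha : Measurable a) (hV : Measurable V)
    (hC : ∀ᵐ u ∂ν, ‖V u‖ ≤ C) (x : ℝ) :
    Integrable (fun u => centredIndicator μ (a u) x • V u) ν :=
  integrable_smul_of_bounded hV hC
    (measurable_centredIndicator.comp (ha.prodMk measurable_const))
    (.of_forall fun u => abs_centredIndicator_le (a u) x)

lemma norm_integral_centredIndicator_smul_le (hC : ∀ᵐ u ∂ν, ‖V u‖ ≤ C) (x : ℝ) :
    ‖∫ u, centredIndicator μ (a u) x • V u ∂ν‖ ≤ C * ν.real univ := by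
  refine norm_integral_le_of_norm_le_const ?_
  filter_upwards [hC] with u hu
  rw [norm_smul]
  calc _ ≤ 1 * ‖V u‖ := by
        gcongr
        exact abs_centredIndicator_le _ _
    _ ≤ C := by rwa [one_mul]

variable [IsProbabilityMeasure μ]

lemma integrable_indicator_Iic (a : ℝ) :
    Integrable ((Iic a).indicator fun _ => (1 : ℝ)) μ :=
  (integrable_const 1).indicator measurableSet_Iic

lemma integral_indicator_Iic (a : ℝ) :
    ∫ x, (Iic a).indicator (fun _ => (1 : ℝ)) x ∂μ = cdf μ a := by
  rw [integral_indicator measurableSet_Iic, cdf_eq_real]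
  simp

lemma integral_centredIndicator (a : ℝ) : ∫ x, centredIndicator μ a x ∂μ = 0 := by
  unfold centredIndicator
  rw [integral_sub (integrable_indicator_Iic a) (integrable_const _), integral_indicator_Iic]
  simp

/-- The covariance kernel of the empirical process. -/
lemma integral_centredIndicator_mul (a b : ℝ) :
    ∫ x, centredIndicator μ a x * centredIndicator μ b x ∂μ =
      cdf μ (min a b) - cdf μ a * cdf μ b := by
  -- `1(x ≤ a) 1(x ≤ b) = 1(x ≤ min a b)`
  have e : ∀ x, centredIndicator μ a x * centredIndicator μ b x =
      (Iic (min a b)).indicator (fun _ => (1 : ℝ)) x -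
        cdf μ b * (Iic a).indicator (fun _ => (1 : ℝ)) x -
        cdf μ a * centredIndicator μ b x := by
    intro x
    unfold centredIndicator
    by_cases h1 : x ≤ a <;> by_cases h2 : x ≤ b <;>
      simp only [indicator_apply, mem_Iic, le_min_iff, h1, h2, and_true, and_false, and_self,
        if_true, if_false] <;> ring
  have i1 := integrable_indicator_Iic (μ := μ) (min a b)
  have i2 := (integrable_indicator_Iic (μ := μ) a).const_mul (cdf μ b)
  have i3 : Integrable (fun x => cdf μ a * centredIndicator μ b x) μ :=
    ((integrable_indicator_Iic (μ := μ) b).sub (integrable_const _)).const_mul _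
  have i12 : Integrable (fun x => (Iic (min a b)).indicator (fun _ => (1 : ℝ)) x -
      cdf μ b * (Iic a).indicator (fun _ => (1 : ℝ)) x) μ := i1.sub i2
  simp_rw [e]
  rw [integral_sub i12 i3, integral_sub i1 i2, integral_const_mul, integral_const_mul,
    integral_centredIndicator, integral_indicator_Iic, integral_indicator_Iic]
  ring

lemma integrable_prod_centredIndicator_mul (ha : Measurable a) {w : ℝ → ℝ} (hw : Measurable w)
    (hC : ∀ᵐ u ∂ν, |w u| ≤ C) :
    Integrable (fun p : ℝ × ℝ => centredIndicator μ (a p.2) p.1 * w p.2) (μ.prod ν) := by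
  refine integrable_of_measurable_of_le (C := C)
    ((measurable_centredIndicator.comp ((ha.comp measurable_snd).prodMk measurable_fst)).mul
      (hw.comp measurable_snd)) ?_
  have : ∀ᵐ p ∂(μ.prod ν), |w p.2| ≤ C := Measure.quasiMeasurePreserving_snd.ae hC
  filter_upwards [this] with p hp
  rw [abs_mul]
  calc _ ≤ 1 * |w p.2| := by
        gcongr
        exact abs_centredIndicator_le _ _
    _ ≤ C := by rwa [one_mul]

lemma integral_inner_integral_centredIndicator_smul (ha : Measurable a) (hV : Measurable V)
    (hC : ∀ᵐ u ∂ν, ‖V u‖ ≤ C) (s : EuclideanSpace ℝ (Fin d)) :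
    ∫ x, inner ℝ (∫ u, centredIndicator μ (a u) x • V u ∂ν) s ∂μ = 0 := by
  simp_rw [inner_integral_smul (integrable_centredIndicator_smul ha hV hC _)]
  rw [integral_integral_swap (integrable_prod_centredIndicator_mul ha hV.inner_const
    (ae_abs_inner_le hC s))]
  simp_rw [integral_mul_const, integral_centredIndicator]
  simp

/-- Fubini: the second moments of an integral of the centred indicator process. -/
lemma integral_integral_mul_integral_centredIndicator (ha : Measurable a) {w₁ w₂ : ℝ → ℝ}
    (hw₁ : Measurable w₁) (hw₂ : Measurable w₂) (hC₁ : ∀ᵐ u ∂ν, |w₁ u| ≤ C)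
    (hC₂ : ∀ᵐ u ∂ν, |w₂ u| ≤ C) :
    ∫ x, (∫ u, centredIndicator μ (a u) x * w₁ u ∂ν) *
        (∫ v, centredIndicator μ (a v) x * w₂ v ∂ν) ∂μ =
      ∫ u, ∫ v, w₁ u * w₂ v * (cdf μ (min (a u) (a v)) - cdf μ (a u) * cdf μ (a v)) ∂ν ∂ν := by
  have hm : ∀ w : ℝ → ℝ, Measurable w → Measurable fun p : ℝ × ℝ × ℝ =>
      centredIndicator μ (a p.2.1) p.1 * w p.2.1 := fun w hw =>
    (measurable_centredIndicator.comp ((ha.comp measurable_snd.fst).prodMk measurable_fst)).mul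
      (hw.comp measurable_snd.fst)
  have hm' : ∀ w : ℝ → ℝ, Measurable w → Measurable fun p : ℝ × ℝ × ℝ =>
      centredIndicator μ (a p.2.2) p.1 * w p.2.2 := fun w hw =>
    (measurable_centredIndicator.comp ((ha.comp measurable_snd.snd).prodMk measurable_fst)).mul
      (hw.comp measurable_snd.snd)
  have hb : ∀ {w : ℝ → ℝ} {b x u : ℝ}, |w u| ≤ C → |centredIndicator μ b x * w u| ≤ C := by
    intro w b x u hu
    rw [abs_mul]
    calc _ ≤ 1 * |w u| := by
          gcongr
          exact abs_centredIndicator_le _ _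
      _ ≤ C := by rwa [one_mul]
  have hint : Integrable (fun p : ℝ × ℝ × ℝ => (centredIndicator μ (a p.2.1) p.1 * w₁ p.2.1) *
      (centredIndicator μ (a p.2.2) p.1 * w₂ p.2.2)) (μ.prod (ν.prod ν)) := by
    refine integrable_of_measurable_of_le (C := C * C) ((hm _ hw₁).mul (hm' _ hw₂)) ?_
    have h1 : ∀ᵐ p ∂(μ.prod (ν.prod ν)), |w₁ p.2.1| ≤ C :=
      Measure.quasiMeasurePreserving_snd.ae (Measure.quasiMeasurePreserving_fst.ae hC₁)
    have h2 : ∀ᵐ p ∂(μ.prod (ν.prod ν)), |w₂ p.2.2| ≤ C :=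
      Measure.quasiMeasurePreserving_snd.ae (Measure.quasiMeasurePreserving_snd.ae hC₂)
    filter_upwards [h1, h2] with p hp1 hp2
    rw [abs_mul]
    exact mul_le_mul (hb hp1) (hb hp2) (abs_nonneg _) ((abs_nonneg _).trans hp1)
  simp_rw [← integral_prod_mul]
  rw [integral_integral_swap hint]
  have e : ∀ p : ℝ × ℝ, ∫ x, (centredIndicator μ (a p.1) x * w₁ p.1) *
      (centredIndicator μ (a p.2) x * w₂ p.2) ∂μ = w₁ p.1 * w₂ p.2 *
        (cdf μ (min (a p.1) (a p.2)) - cdf μ (a p.1) * cdf μ (a p.2)) := by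
    intro p
    rw [← integral_centredIndicator_mul, ← integral_const_mul]
    refine integral_congr_ae (.of_forall fun x => ?_)
    simp only
    ring
  simp_rw [e]
  rw [integral_prod]
  exact hint.integral_prod_right.congr (.of_forall e)

end EmpiricalProcess

/-! ### The local design measure -/

lemma IsKernel.measurable {K : ℝ → ℝ} (hK : IsKernel K) : Measurable K := by
  classical
  have h := hK.continuousOn.measurable_piecewise (g := fun _ => (0 : ℝ)) continuousOn_const
    measurableSet_Icc
  convert h using 1
  ext u
  by_cases hu : u ∈ Icc (-1 : ℝ) 1
  · simp only [piecewise_eq_of_mem _ _ _ hu]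
  · simp only [piecewise_eq_of_notMem _ _ _ hu, hK.eq_zero u hu]

lemma IsKernel.exists_le {K : ℝ → ℝ} (hK : IsKernel K) : ∃ C, 0 ≤ C ∧ ∀ u, K u ≤ C := by
  obtain ⟨C, hC⟩ := isCompact_Icc.exists_bound_of_continuousOn hK.continuousOn
  refine ⟨max C 0, le_max_right _ _, fun u => ?_⟩
  by_cases hu : u ∈ Icc (-1 : ℝ) 1
  · exact (le_abs_self _).trans ((hC u hu).trans (le_max_left _ _))
  · rw [hK.eq_zero u hu]
    exact le_max_right _ _

/-- The one-sided second-order suprema bound the density from above. -/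
lemma HasSmoothDensityNear.exists_bound {H f : ℝ → ℝ} {x₀ : ℝ} (hf : HasSmoothDensityNear H f x₀) :
    ∃ δ M : ℝ, 0 < δ ∧ 0 ≤ M ∧ IntervalIntegrable f volume (x₀ - δ) (x₀ + δ) ∧
      (∀ t ∈ Icc (x₀ - δ) (x₀ + δ), 0 ≤ f t ∧ f t ≤ M) ∧
      ∀ a ∈ Icc (x₀ - δ) (x₀ + δ), ∀ b ∈ Icc (x₀ - δ) (x₀ + δ), H b - H a = ∫ t in a..b, f t := by
  obtain ⟨δ, hδ, hint, hnn, hH, fl, fr, dfl, dfr, ⟨Ml, hMl⟩, ⟨Mr, hMr⟩⟩ := hf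
  have aux : ∀ {c e B u : ℝ}, u ≠ 0 → |u| ≤ δ → (f (x₀ + u) - c - u * e) / u ^ 2 ≤ B →
      f (x₀ + u) ≤ |c| + δ * |e| + |B| * δ ^ 2 := by
    intro c e B u hu hud hB
    have hu2 : 0 < u ^ 2 := by positivity
    rw [div_le_iff₀ hu2] at hB
    have h1 : u * e ≤ δ * |e| := by
      calc u * e ≤ |u * e| := le_abs_self _
        _ = |u| * |e| := abs_mul _ _
        _ ≤ δ * |e| := by gcongr
    have h2 : B * u ^ 2 ≤ |B| * δ ^ 2 := by
      rw [← sq_abs u]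
      gcongr
      exact le_abs_self B
    linarith [le_abs_self c]
  refine ⟨δ, max (f x₀) (max (|fl| + δ * |dfl| + |Ml| * δ ^ 2) (|fr| + δ * |dfr| + |Mr| * δ ^ 2)),
    hδ, (hnn x₀ ⟨by linarith, by linarith⟩).trans (le_max_left _ _), hint,
    fun t ht => ⟨hnn t ht, ?_⟩, hH⟩
  rcases lt_trichotomy t x₀ with hlt | rfl | hlt
  · refine le_max_of_le_right (le_max_of_le_left ?_)
    have := aux (u := t - x₀) (by linarith) (abs_le.2 ⟨by linarith [ht.1], by linarith⟩)
      (hMl ⟨t - x₀, ⟨by linarith [ht.1], by linarith⟩, rfl⟩)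
    simpa using this
  · exact le_max_left _ _
  · refine le_max_of_le_right (le_max_of_le_right ?_)
    have := aux (u := t - x₀) (by linarith) (abs_le.2 ⟨by linarith, by linarith [ht.2]⟩)
      (hMr ⟨t - x₀, ⟨by linarith, by linarith [ht.2]⟩, rfl⟩)
    simpa using this

lemma measurableSet_scaledSupport (μ : Measure ℝ) (x₀ h : ℝ) :
    MeasurableSet (scaledSupport μ x₀ h) := by
  have : scaledSupport μ x₀ h = (fun u => x₀ + h * u) ⁻¹' μ.support := rfl
  rw [this]
  exact Measure.isClosed_support.measurableSet.preimage (by fun_prop)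

/-- The measure `K(u) g(x₀ + h u) du` on the rescaled support, against which all the local
integrals are taken. -/
noncomputable def designMeasure (μ : Measure ℝ) (K g : ℝ → ℝ) (x₀ h : ℝ) : Measure ℝ :=
  (volume.restrict (scaledSupport μ x₀ h)).withDensity
    fun u => ENNReal.ofReal (K u * g (x₀ + h * u))

section DesignMeasure

variable {d : ℕ} {μ : Measure ℝ} {K g : ℝ → ℝ} {x₀ h M : ℝ}

lemma mem_Icc_of_abs_le_one (hh : 0 ≤ h) {u : ℝ} (hu : u ∈ Icc (-1 : ℝ) 1) :
    x₀ + h * u ∈ Icc (x₀ - h) (x₀ + h) :=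
  ⟨by nlinarith [hu.1], by nlinarith [hu.2]⟩

lemma design_nonneg (hK : IsKernel K) (hh : 0 ≤ h)
    (hg : ∀ t ∈ Icc (x₀ - h) (x₀ + h), 0 ≤ g t ∧ g t ≤ M) (u : ℝ) :
    0 ≤ K u * g (x₀ + h * u) := by
  by_cases hu : u ∈ Icc (-1 : ℝ) 1
  · exact mul_nonneg (hK.nonneg u) (hg _ (mem_Icc_of_abs_le_one hh hu)).1
  · rw [hK.eq_zero u hu, zero_mul]

lemma measurable_design (hK : IsKernel K) (hgm : Measurable g) :
    Measurable fun u => ENNReal.ofReal (K u * g (x₀ + h * u)) :=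
  (hK.measurable.mul (hgm.comp (by fun_prop))).ennreal_ofReal

/-- The vanishing of `K` outside `[-1, 1]` confines `x₀ + h u` to `[x₀ - h, x₀ + h]`, so bounds on
`g` are needed there only. -/
lemma setIntegral_scaledSupport_eq {E : Type*} [NormedAddCommGroup E] [NormedSpace ℝ E]
    (hK : IsKernel K) (hgm : Measurable g) (hh : 0 ≤ h)
    (hg : ∀ t ∈ Icc (x₀ - h) (x₀ + h), 0 ≤ g t ∧ g t ≤ M) (φ : ℝ → E) :
    ∫ u in scaledSupport μ x₀ h, (K u * g (x₀ + h * u)) • φ u =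
      ∫ u, φ u ∂(designMeasure μ K g x₀ h) := by
  unfold designMeasure
  rw [integral_withDensity_eq_integral_toReal_smul (measurable_design hK hgm)
    (.of_forall fun u => ENNReal.ofReal_lt_top)]
  simp_rw [ENNReal.toReal_ofReal (design_nonneg hK hh hg _)]

lemma ae_designMeasure_mem_Icc (hK : IsKernel K) (hgm : Measurable g) :
    ∀ᵐ u ∂(designMeasure μ K g x₀ h), u ∈ Icc (-1 : ℝ) 1 := by
  unfold designMeasure
  rw [ae_withDensity_iff (measurable_design hK hgm)]
  refine .of_forall fun u hu => ?_
  by_contra hn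
  rw [hK.eq_zero u hn] at hu
  simp at hu

/-- The factor `2` is the length of `[-1, 1]`; the bound does not depend on `h`. -/
lemma designMeasure_univ_le (hK : IsKernel K) (hh : 0 ≤ h) (hM : 0 ≤ M)
    (hg : ∀ t ∈ Icc (x₀ - h) (x₀ + h), 0 ≤ g t ∧ g t ≤ M) {C : ℝ} (hC0 : 0 ≤ C)
    (hC : ∀ u, K u ≤ C) :
    designMeasure μ K g x₀ h univ ≤ ENNReal.ofReal (C * M * 2) := by
  unfold designMeasure
  rw [withDensity_apply _ MeasurableSet.univ, Measure.restrict_univ]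
  calc ∫⁻ u in scaledSupport μ x₀ h, ENNReal.ofReal (K u * g (x₀ + h * u))
      ≤ ∫⁻ u, ENNReal.ofReal (K u * g (x₀ + h * u)) := setLIntegral_le_lintegral _ _
    _ ≤ ∫⁻ u, (Icc (-1 : ℝ) 1).indicator (fun _ => ENNReal.ofReal (C * M)) u := by
        refine lintegral_mono fun u => ?_
        by_cases hu : u ∈ Icc (-1 : ℝ) 1
        · rw [indicator_of_mem hu]
          have := hg _ (mem_Icc_of_abs_le_one hh hu)
          exact ENNReal.ofReal_le_ofReal (mul_le_mul (hC u) this.2 this.1 hC0)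
        · simp [hK.eq_zero u hu]
    _ = ENNReal.ofReal (C * M * 2) := by
        rw [lintegral_indicator measurableSet_Icc, setLIntegral_const, Real.volume_Icc,
          ENNReal.ofReal_mul (by positivity) (q := 2)]
        norm_num

lemma isFiniteMeasure_designMeasure (hK : IsKernel K) (hh : 0 ≤ h) (hM : 0 ≤ M)
    (hg : ∀ t ∈ Icc (x₀ - h) (x₀ + h), 0 ≤ g t ∧ g t ≤ M) :
    IsFiniteMeasure (designMeasure μ K g x₀ h) := by
  obtain ⟨C, hC0, hC⟩ := hK.exists_le
  exact ⟨(designMeasure_univ_le hK hh hM hg hC0 hC).trans_lt ENNReal.ofReal_lt_top⟩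

lemma designMeasure_real_univ_le (hK : IsKernel K) (hh : 0 ≤ h) (hM : 0 ≤ M)
    (hg : ∀ t ∈ Icc (x₀ - h) (x₀ + h), 0 ≤ g t ∧ g t ≤ M) {C : ℝ} (hC0 : 0 ≤ C)
    (hC : ∀ u, K u ≤ C) :
    (designMeasure μ K g x₀ h).real univ ≤ C * M * 2 :=
  ENNReal.toReal_le_of_le_ofReal (by positivity) (designMeasure_univ_le hK hh hM hg hC0 hC)

lemma Gam_eq (R : ℝ → EuclideanSpace ℝ (Fin d)) (hK : IsKernel K) (hgm : Measurable g)
    (hh : 0 ≤ h) (hg : ∀ t ∈ Icc (x₀ - h) (x₀ + h), 0 ≤ g t ∧ g t ≤ M) (j k : Fin d) :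
    Gam μ R K g x₀ h j k = ∫ u, R u j * R u k ∂(designMeasure μ K g x₀ h) := by
  rw [← setIntegral_scaledSupport_eq hK hgm hh hg]
  simp only [Gam, Matrix.of_apply, smul_eq_mul]
  congr 1 with u
  ring

lemma Sig_eq (R : ℝ → EuclideanSpace ℝ (Fin d)) (hK : IsKernel K) (hgm : Measurable g)
    (hh : 0 ≤ h) (hg : ∀ t ∈ Icc (x₀ - h) (x₀ + h), 0 ≤ g t ∧ g t ≤ M) (j k : Fin d) :
    Sig μ R K g x₀ h j k = ∫ u, ∫ v, R u j * R v k *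
      (cdf μ (min (x₀ + h * u) (x₀ + h * v)) - cdf μ (x₀ + h * u) * cdf μ (x₀ + h * v))
      ∂(designMeasure μ K g x₀ h) ∂(designMeasure μ K g x₀ h) := by
  rw [← setIntegral_scaledSupport_eq hK hgm hh hg]
  simp only [Sig, Matrix.of_apply, smul_eq_mul]
  congr 1 with u
  rw [← setIntegral_scaledSupport_eq hK hgm hh hg, ← integral_const_mul]
  congr 1 with v
  rw [min_add_add_left, ← mul_min_of_nonneg _ _ hh, smul_eq_mul]
  ring

lemma influence_eq (R : ℝ → EuclideanSpace ℝ (Fin d)) (hK : IsKernel K) (hgm : Measurable g)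
    (hh : 0 ≤ h) (hg : ∀ t ∈ Icc (x₀ - h) (x₀ + h), 0 ≤ g t ∧ g t ≤ M) (x : ℝ) :
    influence μ R K g x₀ h x =
      ∫ u, centredIndicator μ (x₀ + h * u) x • R u ∂(designMeasure μ K g x₀ h) := by
  rw [← setIntegral_scaledSupport_eq hK hgm hh hg]
  unfold influence centredIndicator
  congr 1 with u : 1
  rw [smul_smul]
  congr 1
  ring

lemma measurable_influence {R : ℝ → EuclideanSpace ℝ (Fin d)} (hR : Measurable R)
    (hK : IsKernel K) (hgm : Measurable g) : Measurable (influence μ R K g x₀ h) := by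
  have hm : Measurable fun p : ℝ × ℝ =>
      (centredIndicator μ (x₀ + h * p.2) p.1 * K p.2 * g (x₀ + h * p.2)) • R p.2 := by
    refine Measurable.smul (((measurable_centredIndicator.comp
      (Measurable.prodMk (by fun_prop) measurable_fst)).mul
      (hK.measurable.comp measurable_snd)).mul (hgm.comp (by fun_prop)))
      (hR.comp measurable_snd)
  exact (hm.stronglyMeasurable.integral_prod_right'
    (ν := volume.restrict (scaledSupport μ x₀ h))).measurable

end DesignMeasure

/-! ### The scaling basis -/

section Basis

variable {d : ℕ} {R : ℝ → EuclideanSpace ℝ (Fin d)} {Υ : ℝ → Matrix (Fin d) (Fin d) ℝ}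

lemma IsScalingBasis.exists_le (hR : IsScalingBasis R Υ) :
    ∃ C, 0 ≤ C ∧ ∀ u ∈ Icc (-1 : ℝ) 1, ‖R u‖ ≤ C := by
  obtain ⟨C, hC⟩ := hR.locallyBounded 1
  exact ⟨C, (norm_nonneg _).trans (hC 0 (by simp)), hC⟩

lemma IsScalingBasis.isUnit_det (hR : IsScalingBasis R Υ) {h : ℝ} (hh : 0 < h) :
    IsUnit (Υ h).det :=
  (Matrix.isUnit_iff_isUnit_det _).1 (hR.posDef h hh).isUnit

lemma IsScalingBasis.inv_apply (hR : IsScalingBasis R Υ) {h : ℝ} (hh : 0 < h) (u : ℝ) :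
    Matrix.toEuclideanLin (Υ h)⁻¹ (R u) = R (h * u) := by
  have := hR.scaling h hh (h * u)
  rw [mul_div_cancel_left₀ _ hh.ne'] at this
  rw [← this, ← toEuclideanLin_mul_apply, Matrix.nonsing_inv_mul _ (hR.isUnit_det hh),
    toEuclideanLin_one_apply]

lemma IsScalingBasis.inner_rescale (hR : IsScalingBasis R Υ) {h : ℝ} (hh : 0 < h) (u : ℝ)
    (t : EuclideanSpace ℝ (Fin d)) :
    inner ℝ (R (h * u)) t = inner ℝ (R u) (Matrix.toEuclideanLin (Υ h)⁻¹ t) := by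
  have hT : ((Υ h)⁻¹).transpose = (Υ h)⁻¹ := by
    have := (hR.posDef h hh).inv.isHermitian
    simpa [Matrix.IsHermitian, Matrix.conjTranspose_eq_transpose_of_trivial] using this
  rw [← hR.inv_apply hh, inner_toEuclideanLin_transpose, hT]

lemma IsScalingBasis.abs_sub_le_approxError (hR : IsScalingBasis R Υ) {μ : Measure ℝ} {x₀ h : ℝ}
    (hh : 0 < h) (θ : EuclideanSpace ℝ (Fin d)) {u : ℝ} (hu : u ∈ Icc (-1 : ℝ) 1) :
    |cdf μ (x₀ + h * u) - inner ℝ (R (h * u)) θ| ≤ approxError μ R x₀ θ h := by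
  refine le_csSup ?_ ⟨x₀ + h * u, mem_Icc_of_abs_le_one hh.le hu, by simp⟩
  obtain ⟨C, hC⟩ := hR.locallyBounded h
  refine ⟨1 + C * ‖θ‖, ?_⟩
  rintro _ ⟨x, hx, rfl⟩
  refine (abs_sub _ _).trans (add_le_add ?_ ?_)
  · rw [abs_of_nonneg (cdf_nonneg μ x)]
    exact cdf_le_one μ x
  · refine (abs_real_inner_le_norm _ _).trans ?_
    gcongr
    exact hC _ ⟨by linarith [hx.1], by linarith [hx.2]⟩

lemma IsScalingBasis.approxError_nonneg (hR : IsScalingBasis R Υ) {μ : Measure ℝ} {x₀ h : ℝ}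
    (hh : 0 < h) (θ : EuclideanSpace ℝ (Fin d)) : 0 ≤ approxError μ R x₀ θ h :=
  (abs_nonneg _).trans (hR.abs_sub_le_approxError hh θ (u := 0) (by simp))

variable {μ : Measure ℝ} {K g : ℝ → ℝ} {x₀ h M : ℝ}

lemma biasIntegral_eq (hR : IsScalingBasis R Υ) (hK : IsKernel K) (hgm : Measurable g)
    (hh : 0 < h) (hg : ∀ t ∈ Icc (x₀ - h) (x₀ + h), 0 ≤ g t ∧ g t ≤ M)
    (θ : EuclideanSpace ℝ (Fin d)) :
    biasIntegral μ R Υ K g x₀ θ h =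
      ∫ u, (cdf μ (x₀ + h * u) - inner ℝ (R (h * u)) θ) • R u ∂(designMeasure μ K g x₀ h) := by
  rw [← setIntegral_scaledSupport_eq hK hgm hh.le hg]
  unfold biasIntegral
  congr 1 with u : 1
  rw [smul_smul, hR.inv_apply hh]
  congr 1
  ring

/-- `C * M * 2` bounds the mass of the design measure. -/
lemma norm_biasIntegral_le (hR : IsScalingBasis R Υ) (hK : IsKernel K) (hgm : Measurable g)
    (hh : 0 < h) (hM : 0 ≤ M) (hg : ∀ t ∈ Icc (x₀ - h) (x₀ + h), 0 ≤ g t ∧ g t ≤ M)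
    (θ : EuclideanSpace ℝ (Fin d)) {C D : ℝ} (hC0 : 0 ≤ C) (hC : ∀ u, K u ≤ C) (hD0 : 0 ≤ D)
    (hD : ∀ u ∈ Icc (-1 : ℝ) 1, ‖R u‖ ≤ D) :
    ‖biasIntegral μ R Υ K g x₀ θ h‖ ≤ D * (C * M * 2) * approxError μ R x₀ θ h := by
  have := isFiniteMeasure_designMeasure (μ := μ) hK hh.le hM hg
  have hϱ := hR.approxError_nonneg (μ := μ) (x₀ := x₀) hh θ
  rw [biasIntegral_eq hR hK hgm hh hg]
  have h1 := norm_integral_le_of_norm_le_const (μ := designMeasure μ K g x₀ h)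
    (f := fun u => (cdf μ (x₀ + h * u) - inner ℝ (R (h * u)) θ) • R u)
    (C := approxError μ R x₀ θ h * D) (by
      filter_upwards [ae_designMeasure_mem_Icc hK hgm] with u hu
      rw [norm_smul]
      exact mul_le_mul (hR.abs_sub_le_approxError hh θ hu) (hD u hu) (norm_nonneg _) hϱ)
  refine h1.trans ?_
  calc _ ≤ approxError μ R x₀ θ h * D * (C * M * 2) := by
        gcongr
        exact designMeasure_real_univ_le hK hh.le hM hg hC0 hC
    _ = _ := by ring

end Basis

/-! ### The weighting measure near the evaluation point -/

lemma restrict_measure_eq_withDensity {G : StieltjesFunction ℝ} {g : ℝ → ℝ} {a b : ℝ}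
    (hint : IntegrableOn g (Ioc a b)) (hnn : ∀ t ∈ Icc a b, 0 ≤ g t)
    (hG : ∀ s ∈ Icc a b, ∀ t ∈ Icc a b, G t - G s = ∫ y in s..t, g y) :
    G.measure.restrict (Ioc a b) =
      (volume.withDensity fun y => ENNReal.ofReal (g y)).restrict (Ioc a b) := by
  refine Measure.ext_of_Ioc _ _ fun s t _ => ?_
  rw [Measure.restrict_apply measurableSet_Ioc, Measure.restrict_apply measurableSet_Ioc,
    Ioc_inter_Ioc]
  rcases le_or_gt (min t b) (max s a) with h | h
  · rw [Ioc_eq_empty (not_lt.2 h)]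
    simp
  · have hl : max s a ∈ Icc a b := ⟨le_max_right _ _, h.le.trans (min_le_right _ _)⟩
    have hr : min t b ∈ Icc a b := ⟨(le_max_right _ _).trans h.le, min_le_right _ _⟩
    have hsub : Ioc (max s a) (min t b) ⊆ Ioc a b :=
      Ioc_subset_Ioc (le_max_right _ _) (min_le_right _ _)
    rw [StieltjesFunction.measure_Ioc, hG _ hl _ hr, withDensity_apply _ measurableSet_Ioc,
      intervalIntegral.integral_of_le h.le]
    refine ofReal_integral_eq_lintegral_ofReal (hint.mono_set hsub) ?_
    refine (ae_restrict_iff' measurableSet_Ioc).2 (.of_forall fun y hy => ?_)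
    exact hnn y (Ioc_subset_Icc_self (hsub hy))

/-- Integrals against `G` of functions vanishing outside an interval on which `G` has density
`g`. -/
lemma setIntegral_measure_eq {G : StieltjesFunction ℝ} {g : ℝ → ℝ} (hgm : Measurable g) {a b : ℝ}
    (hint : IntegrableOn g (Ioc a b)) (hnn : ∀ t ∈ Icc a b, 0 ≤ g t)
    (hG : ∀ s ∈ Icc a b, ∀ t ∈ Icc a b, G t - G s = ∫ y in s..t, g y) {S : Set ℝ}
    (hS : MeasurableSet S) {Φ : ℝ → ℝ} (hΦ : ∀ y, y ∉ Ioc a b → Φ y = 0) :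
    ∫ y in S, Φ y ∂G.measure = ∫ y in S, g y * Φ y := by
  have hSI : MeasurableSet (S ∩ Ioc a b) := hS.inter measurableSet_Ioc
  rw [setIntegral_eq_of_subset_of_forall_sdiff_eq_zero hS (inter_subset_left (t := Ioc a b))
    (fun y hy => hΦ y fun h => hy.2 ⟨hy.1, h⟩)]
  rw [setIntegral_eq_of_subset_of_forall_sdiff_eq_zero (f := fun y => g y * Φ y) hS
    (inter_subset_left (t := Ioc a b))
    (fun y hy => by rw [hΦ y fun h => hy.2 ⟨hy.1, h⟩, mul_zero])]
  rw [← Measure.restrict_restrict hS, restrict_measure_eq_withDensity hint hnn hG,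
    Measure.restrict_restrict hS, setIntegral_withDensity_eq_setIntegral_toReal_smul
      hgm.ennreal_ofReal (.of_forall fun y => ENNReal.ofReal_lt_top) _ hSI]
  refine setIntegral_congr_fun hSI fun y hy => ?_
  rw [smul_eq_mul, ENNReal.toReal_ofReal (hnn y (Ioc_subset_Icc_self hy.2))]

lemma setIntegral_rescale (μ : Measure ℝ) {x₀ h : ℝ} (hh : 0 < h) (φ : ℝ → ℝ) :
    ∫ y in μ.support, φ y = h * ∫ u in scaledSupport μ x₀ h, φ (x₀ + h * u) := by
  have hS : MeasurableSet μ.support := Measure.isClosed_support.measurableSet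
  rw [← integral_indicator hS, ← integral_indicator (measurableSet_scaledSupport μ x₀ h)]
  have e : ∀ u, (scaledSupport μ x₀ h).indicator (fun u => φ (x₀ + h * u)) u =
      (fun z => μ.support.indicator φ (x₀ + z)) (h * u) := by
    intro u
    by_cases hu : u ∈ scaledSupport μ x₀ h
    · have hu' : x₀ + h * u ∈ μ.support := hu
      simp only [indicator_of_mem hu, indicator_of_mem hu']
    · have hu' : x₀ + h * u ∉ μ.support := hu
      simp only [indicator_of_notMem hu, indicator_of_notMem hu']
  rw [integral_congr_ae (.of_forall e),
    Measure.integral_comp_mul_left (fun z => μ.support.indicator φ (x₀ + z)),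
    integral_add_left_eq_self, smul_eq_mul,
    abs_of_pos (inv_pos.2 hh), mul_inv_cancel_left₀ hh.ne']

section Estimator

variable {d : ℕ} {R : ℝ → EuclideanSpace ℝ (Fin d)} {Υ : ℝ → Matrix (Fin d) (Fin d) ℝ}
  {μ : Measure ℝ} {K g : ℝ → ℝ} {x₀ h δ M : ℝ} {G : StieltjesFunction ℝ} {Ω : Type*}

/-- After the change of variables `y = x₀ + h u`, the criterion is a least squares criterion
for the design measure. -/
lemma criterion_eq (hK : IsKernel K) (hgm : Measurable g) (hh : 0 < h) (hhδ : h < δ)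
    (hint : IntervalIntegrable g volume (x₀ - δ) (x₀ + δ))
    (hg : ∀ t ∈ Icc (x₀ - δ) (x₀ + δ), 0 ≤ g t ∧ g t ≤ M)
    (hG : ∀ a ∈ Icc (x₀ - δ) (x₀ + δ), ∀ b ∈ Icc (x₀ - δ) (x₀ + δ),
      G b - G a = ∫ t in a..b, g t)
    (X : ℕ → Ω → ℝ) (n : ℕ) (ω : Ω) (t : EuclideanSpace ℝ (Fin d)) :
    criterion μ R K G x₀ h X n ω t =
      ∫ u, (empCdf X n ω (x₀ + h * u) - inner ℝ (R (h * u)) t) ^ 2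
        ∂(designMeasure μ K g x₀ h) := by
  have hg' : ∀ t ∈ Icc (x₀ - h) (x₀ + h), 0 ≤ g t ∧ g t ≤ M := fun t ht =>
    hg t ⟨by linarith [ht.1], by linarith [ht.2]⟩
  unfold criterion
  rw [setIntegral_measure_eq hgm
    ((intervalIntegrable_iff_integrableOn_Ioc_of_le (by linarith)).1 hint)
    (fun t ht => (hg t ht).1) hG Measure.isClosed_support.measurableSet, setIntegral_rescale μ hh,
    ← setIntegral_scaledSupport_eq hK hgm hh.le hg', ← integral_const_mul]
  · congr 1 with u
    rw [add_sub_cancel_left, mul_div_cancel_left₀ _ hh.ne', smul_eq_mul]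
    field_simp
  · intro y hy
    rw [hK.eq_zero ((y - x₀) / h), mul_zero, mul_zero]
    intro hmem
    refine hy ⟨?_, ?_⟩
    · have := (le_div_iff₀ hh).1 hmem.1
      linarith
    · have := (div_le_iff₀ hh).1 hmem.2
      linarith

lemma measurable_empCdf (X : ℕ → Ω → ℝ) (n : ℕ) (ω : Ω) : Measurable (empCdf X n ω) := by
  unfold empCdf
  refine Measurable.const_mul (Finset.measurable_fun_sum _ fun i _ => ?_) _
  exact measurable_indicator_Iic.comp (measurable_id.prodMk measurable_const)

lemma abs_empCdf_le (X : ℕ → Ω → ℝ) (n : ℕ) (ω : Ω) (t : ℝ) : |empCdf X n ω t| ≤ 1 := by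
  unfold empCdf
  rw [abs_mul, abs_inv, Nat.abs_cast]
  have : |∑ i ∈ Finset.range n, (Iic t).indicator (fun _ => (1 : ℝ)) (X i ω)| ≤ n := by
    refine (Finset.abs_sum_le_sum_abs _ _).trans ?_
    calc _ ≤ ∑ i ∈ Finset.range n, (1 : ℝ) := Finset.sum_le_sum fun i _ => by
          by_cases h : X i ω ∈ Iic t <;> simp [h]
      _ = n := by simp
  rcases eq_or_ne n 0 with rfl | hn
  · simp
  · rw [inv_mul_le_iff₀ (by positivity), mul_one]
    exact this

lemma empCdf_sub_cdf {n : ℕ} (hn : n ≠ 0) (X : ℕ → Ω → ℝ) (ω : Ω) (t : ℝ) :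
    empCdf X n ω t - cdf μ t = (n : ℝ)⁻¹ * ∑ i ∈ Finset.range n, centredIndicator μ t (X i ω) := by
  unfold empCdf centredIndicator
  rw [Finset.sum_sub_distrib]
  simp only [Finset.sum_const, Finset.card_range, nsmul_eq_mul]
  field_simp

/-- The estimator solves the normal equations; the minimizer is unique because `Γ_h` is positive
definite. -/
lemma isLocalL2Estimate_iff (hR : IsScalingBasis R Υ) (hK : IsKernel K) (hgm : Measurable g)
    (hh : 0 < h) (hhδ : h < δ) (hM : 0 ≤ M)
    (hint : IntervalIntegrable g volume (x₀ - δ) (x₀ + δ))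
    (hg : ∀ t ∈ Icc (x₀ - δ) (x₀ + δ), 0 ≤ g t ∧ g t ≤ M)
    (hG : ∀ a ∈ Icc (x₀ - δ) (x₀ + δ), ∀ b ∈ Icc (x₀ - δ) (x₀ + δ),
      G b - G a = ∫ t in a..b, g t)
    {c : ℝ} (hc0 : 0 < c) (hc : ∀ s : EuclideanSpace ℝ (Fin d),
      c * ‖s‖ ^ 2 ≤ inner ℝ s (Matrix.toEuclideanLin (Gam μ R K g x₀ h) s))
    (hpd : (Gam μ R K g x₀ h).PosDef) (X : ℕ → Ω → ℝ) (n : ℕ) (ω : Ω)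
    (t : EuclideanSpace ℝ (Fin d)) :
    IsLocalL2Estimate μ R K G x₀ h X n ω t ↔
      t = Matrix.toEuclideanLin (Υ h * (Gam μ R K g x₀ h)⁻¹)
        (∫ u, empCdf X n ω (x₀ + h * u) • R u ∂(designMeasure μ K g x₀ h)) := by
  have hg' : ∀ t ∈ Icc (x₀ - h) (x₀ + h), 0 ≤ g t ∧ g t ≤ M := fun t ht =>
    hg t ⟨by linarith [ht.1], by linarith [ht.2]⟩
  have := isFiniteMeasure_designMeasure (μ := μ) hK hh.le hM hg'
  obtain ⟨D, hD0, hD⟩ := hR.exists_le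
  set ν := designMeasure μ K g x₀ h
  have hDν : ∀ᵐ u ∂ν, ‖R u‖ ≤ D := by
    filter_upwards [ae_designMeasure_mem_Icc hK hgm] with u hu using hD u hu
  set Γ := Gam μ R K g x₀ h
  set β := Matrix.toEuclideanLin Γ⁻¹ (∫ u, empCdf X n ω (x₀ + h * u) • R u ∂ν) with hβ
  have hU := hR.isUnit_det hh
  have hcrit : ∀ t', criterion μ R K G x₀ h X n ω t' =
      ∫ u, (empCdf X n ω (x₀ + h * u) - inner ℝ (R u) β) ^ 2 ∂ν +
      inner ℝ (Matrix.toEuclideanLin (Υ h)⁻¹ t' - β)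
        (Matrix.toEuclideanLin Γ (Matrix.toEuclideanLin (Υ h)⁻¹ t' - β)) := by
    intro t'
    rw [criterion_eq hK hgm hh hhδ hint hg hG]
    simp_rw [hR.inner_rescale hh]
    exact integral_sq_sub_inner_eq hR.measurable hDν
      ((measurable_empCdf X n ω).comp (by fun_prop))
      (.of_forall fun u => abs_empCdf_le X n ω (x₀ + h * u)) (Gam_eq R hK hgm hh.le hg') hpd _
  have hinv : Matrix.toEuclideanLin (Υ h)⁻¹ (Matrix.toEuclideanLin (Υ h) β) = β := by
    rw [← toEuclideanLin_mul_apply, Matrix.nonsing_inv_mul _ hU, toEuclideanLin_one_apply]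
  rw [toEuclideanLin_mul_apply, ← hβ]
  constructor
  · intro hmin
    -- compare with the candidate minimizer
    have h1 : criterion μ R K G x₀ h X n ω t ≤
      criterion μ R K G x₀ h X n ω (Matrix.toEuclideanLin (Υ h) β) := hmin (mem_univ _)
    rw [hcrit, hcrit, hinv, sub_self, inner_zero_left, add_zero] at h1
    have h2 := hc (Matrix.toEuclideanLin (Υ h)⁻¹ t - β)
    have h3 : ‖Matrix.toEuclideanLin (Υ h)⁻¹ t - β‖ ^ 2 ≤ 0 :=
      nonpos_of_mul_nonpos_right (by linarith) hc0
    have h4 : Matrix.toEuclideanLin (Υ h)⁻¹ t = β := by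
      rw [← sub_eq_zero, ← norm_eq_zero]
      exact pow_eq_zero_iff two_ne_zero |>.1 (le_antisymm h3 (sq_nonneg _))
    rw [← h4, ← toEuclideanLin_mul_apply, Matrix.mul_nonsing_inv _ hU, toEuclideanLin_one_apply]
  · rintro rfl t' -
    change criterion μ R K G x₀ h X n ω _ ≤ criterion μ R K G x₀ h X n ω t'
    rw [hcrit, hcrit, hinv, sub_self, inner_zero_left, add_zero]
    have h2 := hc (Matrix.toEuclideanLin (Υ h)⁻¹ t' - β)
    have h3 : 0 ≤ c * ‖Matrix.toEuclideanLin (Υ h)⁻¹ t' - β‖ ^ 2 := by positivity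
    linarith

/-- The right-hand side of the normal equations, centred at the rescaled target parameter. -/
lemma integral_empCdf_smul_eq (hR : IsScalingBasis R Υ) (hK : IsKernel K) (hgm : Measurable g)
    (hh : 0 < h) (hM : 0 ≤ M) (hg : ∀ t ∈ Icc (x₀ - h) (x₀ + h), 0 ≤ g t ∧ g t ≤ M)
    (θ : EuclideanSpace ℝ (Fin d)) (X : ℕ → Ω → ℝ) {n : ℕ} (hn : n ≠ 0) (ω : Ω) :
    ∫ u, empCdf X n ω (x₀ + h * u) • R u ∂(designMeasure μ K g x₀ h) =
      Matrix.toEuclideanLin (Gam μ R K g x₀ h) (Matrix.toEuclideanLin (Υ h)⁻¹ θ) +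
        biasIntegral μ R Υ K g x₀ θ h +
        (n : ℝ)⁻¹ • ∑ i ∈ Finset.range n, influence μ R K g x₀ h (X i ω) := by
  have := isFiniteMeasure_designMeasure (μ := μ) hK hh.le hM hg
  obtain ⟨D, hD0, hD⟩ := hR.exists_le
  simp_rw [influence_eq R hK hgm hh.le hg]
  rw [biasIntegral_eq hR hK hgm hh hg]
  have hΓ := Gam_eq (μ := μ) R hK hgm hh.le hg
  set ν := designMeasure μ K g x₀ h
  have hIcc : ∀ᵐ u ∂ν, u ∈ Icc (-1 : ℝ) 1 := ae_designMeasure_mem_Icc hK hgm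
  have hDν : ∀ᵐ u ∂ν, ‖R u‖ ≤ D := by
    filter_upwards [hIcc] with u hu using hD u hu
  have hRm := hR.measurable
  set s := Matrix.toEuclideanLin (Υ h)⁻¹ θ
  have i1 : Integrable (fun u => inner ℝ (R u) s • R u) ν :=
    integrable_smul_of_bounded hRm hDν hRm.inner_const (ae_abs_inner_le hDν s)
  have i2 : Integrable (fun u => (cdf μ (x₀ + h * u) - inner ℝ (R (h * u)) θ) • R u) ν := by
    refine integrable_smul_of_bounded (D := approxError μ R x₀ θ h)
      (Y := fun u => cdf μ (x₀ + h * u) - inner ℝ (R (h * u)) θ) hRm hDν ?_ ?_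
    · exact ((monotone_cdf μ).measurable.comp (by fun_prop)).sub
        (hRm.comp (by fun_prop)).inner_const
    · filter_upwards [hIcc] with u hu using hR.abs_sub_le_approxError hh θ hu
  have i3 : ∀ i, Integrable (fun u => centredIndicator μ (x₀ + h * u) (X i ω) • R u) ν :=
    fun i => integrable_centredIndicator_smul (by fun_prop) hRm hDν (X i ω)
  have i4 : Integrable (fun u => ∑ i ∈ Finset.range n,
      centredIndicator μ (x₀ + h * u) (X i ω) • R u) ν :=
    integrable_finsetSum _ fun i _ => i3 i
  have e1 := toEuclideanLin_eq_integral_smul hRm hDν hΓ s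
  have i5 : Integrable (fun u => (n : ℝ)⁻¹ • ∑ i ∈ Finset.range n,
      centredIndicator μ (x₀ + h * u) (X i ω) • R u) ν := Integrable.smul (n : ℝ)⁻¹ i4
  have i12 : Integrable (fun u => inner ℝ (R u) s • R u +
      (cdf μ (x₀ + h * u) - inner ℝ (R (h * u)) θ) • R u) ν := i1.add i2
  rw [e1, ← integral_add i1 i2, ← integral_finsetSum _ fun i _ => i3 i, ← integral_smul,
    ← integral_add i12 i5]
  refine integral_congr_ae (.of_forall fun u => ?_)
  have h1 := empCdf_sub_cdf (μ := μ) hn X ω (x₀ + h * u)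
  have h2 : inner ℝ (R (h * u)) θ = inner ℝ (R u) s := hR.inner_rescale hh u θ
  change _ = inner ℝ (R u) s • R u + (cdf μ (x₀ + h * u) - inner ℝ (R (h * u)) θ) • R u +
    (n : ℝ)⁻¹ • ∑ i ∈ Finset.range n, centredIndicator μ (x₀ + h * u) (X i ω) • R u
  rw [← Finset.sum_smul, smul_smul, ← h1, h2, ← add_smul, ← add_smul, add_sub_cancel,
    add_sub_cancel]

end Estimator

/-! ### Moments of the influence function and the Gaussian limit -/

section Influence

variable {d : ℕ} {R : ℝ → EuclideanSpace ℝ (Fin d)} {Υ : ℝ → Matrix (Fin d) (Fin d) ℝ}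
  {μ : Measure ℝ} {K g : ℝ → ℝ} {x₀ h M : ℝ}

lemma ae_designMeasure_norm_le (hK : IsKernel K) (hgm : Measurable g) {D : ℝ}
    (hD : ∀ u ∈ Icc (-1 : ℝ) 1, ‖R u‖ ≤ D) :
    ∀ᵐ u ∂(designMeasure μ K g x₀ h), ‖R u‖ ≤ D := by
  filter_upwards [ae_designMeasure_mem_Icc hK hgm] with u hu using hD u hu

lemma norm_influence_le (hK : IsKernel K) (hgm : Measurable g) (hh : 0 ≤ h) (hM : 0 ≤ M)
    (hg : ∀ t ∈ Icc (x₀ - h) (x₀ + h), 0 ≤ g t ∧ g t ≤ M) {C D : ℝ} (hC0 : 0 ≤ C)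
    (hC : ∀ u, K u ≤ C) (hD0 : 0 ≤ D) (hD : ∀ u ∈ Icc (-1 : ℝ) 1, ‖R u‖ ≤ D) (x : ℝ) :
    ‖influence μ R K g x₀ h x‖ ≤ D * (C * M * 2) := by
  have := isFiniteMeasure_designMeasure (μ := μ) hK hh hM hg
  rw [influence_eq R hK hgm hh hg]
  refine (norm_integral_centredIndicator_smul_le (ae_designMeasure_norm_le hK hgm hD) x).trans ?_
  gcongr
  exact designMeasure_real_univ_le hK hh hM hg hC0 hC

lemma memLp_influence {Ω : Type*} [MeasurableSpace Ω] {P : Measure Ω} [IsProbabilityMeasure P]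
    {Y : Ω → ℝ} (hY : Measurable Y) (hR : IsScalingBasis R Υ) (hK : IsKernel K)
    (hgm : Measurable g) (hh : 0 ≤ h) (hM : 0 ≤ M)
    (hg : ∀ t ∈ Icc (x₀ - h) (x₀ + h), 0 ≤ g t ∧ g t ≤ M) :
    MemLp (fun ω => influence μ R K g x₀ h (Y ω)) 2 P := by
  obtain ⟨C, hC0, hC⟩ := hK.exists_le
  obtain ⟨D, hD0, hD⟩ := hR.exists_le
  exact MemLp.of_bound ((measurable_influence hR.measurable hK hgm).comp hY).aestronglyMeasurable _
    (.of_forall fun ω => norm_influence_le hK hgm hh hM hg hC0 hC hD0 hD (Y ω))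

variable [IsProbabilityMeasure μ]

lemma integral_inner_influence (hR : IsScalingBasis R Υ) (hK : IsKernel K) (hgm : Measurable g)
    (hh : 0 ≤ h) (hM : 0 ≤ M) (hg : ∀ t ∈ Icc (x₀ - h) (x₀ + h), 0 ≤ g t ∧ g t ≤ M)
    (s : EuclideanSpace ℝ (Fin d)) :
    ∫ x, inner ℝ (influence μ R K g x₀ h x) s ∂μ = 0 := by
  have := isFiniteMeasure_designMeasure (μ := μ) hK hh hM hg
  obtain ⟨D, -, hD⟩ := hR.exists_le
  simp_rw [influence_eq R hK hgm hh hg]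
  exact integral_inner_integral_centredIndicator_smul (by fun_prop) hR.measurable
    (ae_designMeasure_norm_le hK hgm hD) s

lemma coord_eq_inner_single (v : EuclideanSpace ℝ (Fin d)) (j : Fin d) :
    v j = inner ℝ v (EuclideanSpace.single j 1) := by
  simp [EuclideanSpace.inner_single_right]

/-- `Σ_h` is the matrix of second moments of the influence function. -/
lemma Sig_eq_integral_influence (hR : IsScalingBasis R Υ) (hK : IsKernel K) (hgm : Measurable g)
    (hh : 0 ≤ h) (hM : 0 ≤ M) (hg : ∀ t ∈ Icc (x₀ - h) (x₀ + h), 0 ≤ g t ∧ g t ≤ M)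
    (j k : Fin d) :
    Sig μ R K g x₀ h j k =
      ∫ x, influence μ R K g x₀ h x j * influence μ R K g x₀ h x k ∂μ := by
  have := isFiniteMeasure_designMeasure (μ := μ) hK hh hM hg
  obtain ⟨D, -, hD⟩ := hR.exists_le
  have hDν := ae_designMeasure_norm_le (μ := μ) (x₀ := x₀) (h := h) hK hgm hD
  have hcoord : ∀ x i, influence μ R K g x₀ h x i =
      ∫ u, centredIndicator μ (x₀ + h * u) x * R u i ∂(designMeasure μ K g x₀ h) := by
    intro x i
    rw [influence_eq R hK hgm hh hg, coord_eq_inner_single, inner_integral_smul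
      (integrable_centredIndicator_smul (by fun_prop) hR.measurable hDν x)]
    simp_rw [← coord_eq_inner_single]
  have hb : ∀ i, ∀ᵐ u ∂(designMeasure μ K g x₀ h), |R u i| ≤ D := fun i => by
    filter_upwards [hDν] with u hu using (abs_coord_le _ _).trans hu
  rw [Sig_eq R hK hgm hh hg]
  simp_rw [hcoord]
  rw [integral_integral_mul_integral_centredIndicator (a := fun u => x₀ + h * u) (by fun_prop)
    (measurable_coord hR.measurable j) (measurable_coord hR.measurable k) (hb j) (hb k)]

lemma covariance_influence {Ω : Type*} [MeasurableSpace Ω] {P : Measure Ω}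
    {Y : Ω → ℝ} (hY : Measurable Y) (hlaw : P.map Y = μ) (hR : IsScalingBasis R Υ)
    (hK : IsKernel K) (hgm : Measurable g) (hh : 0 ≤ h) (hM : 0 ≤ M)
    (hg : ∀ t ∈ Icc (x₀ - h) (x₀ + h), 0 ≤ g t ∧ g t ≤ M) (j k : Fin d) :
    covariance (fun ω => influence μ R K g x₀ h (Y ω) j)
      (fun ω => influence μ R K g x₀ h (Y ω) k) P = Sig μ R K g x₀ h j k := by
  have hm := measurable_influence (μ := μ) (x₀ := x₀) (h := h) hR.measurable hK hgm
  have hmean : ∀ i, ∫ x, influence μ R K g x₀ h x i ∂μ = 0 := fun i => by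
    simp_rw [coord_eq_inner_single]
    exact integral_inner_influence hR hK hgm hh hM hg _
  rw [← covariance_map_fun (X := fun x => influence μ R K g x₀ h x j)
    (Y := fun x => influence μ R K g x₀ h x k) (measurable_coord hm j).aestronglyMeasurable
    (measurable_coord hm k).aestronglyMeasurable hY.aemeasurable, hlaw, covariance, hmean, hmean,
    Sig_eq_integral_influence hR hK hgm hh hM hg]
  simp

/-- The quadratic form of `Σ_h` is the second moment of a linear form of the influence function. -/
lemma inner_Sig_eq (hR : IsScalingBasis R Υ) (hK : IsKernel K) (hgm : Measurable g)
    (hh : 0 ≤ h) (hM : 0 ≤ M) (hg : ∀ t ∈ Icc (x₀ - h) (x₀ + h), 0 ≤ g t ∧ g t ≤ M)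
    (s : EuclideanSpace ℝ (Fin d)) :
    inner ℝ s (Matrix.toEuclideanLin (Sig μ R K g x₀ h) s) =
      ∫ x, inner ℝ (influence μ R K g x₀ h x) s ^ 2 ∂μ := by
  obtain ⟨C, hC0, hC⟩ := hK.exists_le
  obtain ⟨D, hD0, hD⟩ := hR.exists_le
  rw [inner_toEuclideanLin_of_integral_mul (integrable_coord_mul_coord
    (measurable_influence hR.measurable hK hgm)
    (.of_forall fun x => norm_influence_le hK hgm hh hM hg hC0 hC hD0 hD x))
    (Sig_eq_integral_influence hR hK hgm hh hM hg)]
  simp_rw [sq]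

lemma measurable_toEuclideanLin (A : Matrix (Fin d) (Fin d) ℝ) :
    Measurable (Matrix.toEuclideanLin A) :=
  (Matrix.toEuclideanLin A).continuous_of_finiteDimensional.measurable

/-- Asymptotic normality of the standardized sums. The summands are bounded by a multiple of
`h^{-1/2}`, because the eigenvalues of `Σ_h` are at least `c h`; divided by `√n` they vanish as
`n h → ∞`. The shift `A n (B n)` carries the bias. -/
theorem tendstoInDistribution_standardized_influence {Ω : Type*} [MeasurableSpace Ω]
    {P : Measure Ω} [IsProbabilityMeasure P] {X : ℕ → Ω → ℝ} (hXmeas : ∀ i, Measurable (X i))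
    (hXindep : iIndepFun X P) (hXlaw : ∀ i, P.map (X i) = μ) (hR : IsScalingBasis R Υ)
    (hK : IsKernel K) (hgm : Measurable g) {h : ℕ → ℝ} (hpos : ∀ n, 0 < h n) (hM : 0 ≤ M)
    (hg : ∀ᶠ n in atTop, ∀ t ∈ Icc (x₀ - h n) (x₀ + h n), 0 ≤ g t ∧ g t ≤ M)
    (hnh : Tendsto (fun n : ℕ => (n : ℝ) * h n) atTop atTop) {c : ℝ} (hc0 : 0 < c)
    (hc : ∀ᶠ n in atTop, ∀ s : EuclideanSpace ℝ (Fin d),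
      c * h n * ‖s‖ ^ 2 ≤ inner ℝ s (Matrix.toEuclideanLin (Sig μ R K g x₀ (h n)) s))
    {A : ℕ → Matrix (Fin d) (Fin d) ℝ}
    (hA : ∀ᶠ n in atTop, A n * Sig μ R K g x₀ (h n) * (A n).transpose = 1)
    {B : ℕ → EuclideanSpace ℝ (Fin d)}
    (hB : Tendsto (fun n => (√(h n))⁻¹ * ‖B n‖) atTop (𝓝 0))
    {T : ℕ → Ω → EuclideanSpace ℝ (Fin d)} (hT : ∀ n, AEMeasurable (T n) P)
    (hTB : ∀ᶠ n : ℕ in atTop, ∀ ω, T n ω = Matrix.toEuclideanLin (A n)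
      (B n + (√(n : ℝ))⁻¹ • ∑ i ∈ Finset.range n, influence μ R K g x₀ (h n) (X i ω))) :
    TendstoInDistribution T atTop
      (id : EuclideanSpace ℝ (Fin d) → EuclideanSpace ℝ (Fin d)) (fun _ => P)
      (multivariateGaussian 0 1) := by
  obtain ⟨C, hC0, hC⟩ := hK.exists_le
  obtain ⟨D, hD0, hD⟩ := hR.exists_le
  have hAle : ∀ᶠ n in atTop, ∀ w, ‖Matrix.toEuclideanLin (A n) w‖ ≤
      (√c)⁻¹ * ((√(h n))⁻¹ * ‖w‖) := by
    filter_upwards [hc, hA] with n hcn hAn w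
    have := norm_le_of_mul_mul_transpose_eq_one hAn (mul_pos hc0 (hpos n)) hcn w
    rwa [Real.sqrt_mul hc0.le, mul_inv, mul_assoc] at this
  refine tendstoInDistribution_gaussian_of_bounded_array (μ := μ) hXmeas hXindep hXlaw hT
    (W := fun n x => Matrix.toEuclideanLin (A n) (influence μ R K g x₀ (h n) x))
    (b := fun n => Matrix.toEuclideanLin (A n) (B n))
    (c := fun n => (√c)⁻¹ * ((√(h n))⁻¹ * (D * (C * M * 2))))
    (fun n => (measurable_toEuclideanLin _).comp (measurable_influence hR.measurable hK hgm))
    ?_ ?_ ?_ ?_ ?_ ?_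
    (fun t => by rw [multivariateGaussian_zero_one, charFun_stdGaussian])
  · refine squeeze_zero_norm' (a := fun n => (√c)⁻¹ * ((√(h n))⁻¹ * ‖B n‖)) ?_ ?_
    · filter_upwards [hAle] with n hn using hn _
    · simpa using hB.const_mul (√c)⁻¹
  · filter_upwards [hTB] with n hn ω
    rw [hn, map_add, map_smul, map_sum]
  · filter_upwards [hAle, hg] with n hn hgn x
    refine (hn _).trans ?_
    gcongr
    exact norm_influence_le hK hgm (hpos n).le hM hgn hC0 hC hD0 hD x
  · have h1 : Tendsto (fun n : ℕ => (√((n : ℝ) * h n))⁻¹) atTop (𝓝 0) :=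
      tendsto_inv_atTop_zero.comp (Real.tendsto_sqrt_atTop.comp hnh)
    have h2 := h1.mul_const ((√c)⁻¹ * (D * (C * M * 2)))
    rw [zero_mul] at h2
    refine h2.congr fun n => ?_
    rw [Real.sqrt_mul (Nat.cast_nonneg n), mul_inv]
    ring
  · intro t
    filter_upwards [hg] with n hgn
    simp_rw [inner_toEuclideanLin_transpose]
    exact integral_inner_influence hR hK hgm (hpos n).le hM hgn _
  · intro t
    filter_upwards [hg, hA] with n hgn hAn
    simp_rw [inner_toEuclideanLin_transpose]
    rw [← inner_Sig_eq hR hK hgm (hpos n).le hM hgn, norm_sq_eq_of_mul_mul_transpose_eq_one hAn]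

end Influence

end LocalL2

/-! ### The limit theorem -/

open LocalL2 in
theorem mainTheorem5 {d : ℕ} {Ω : Type*} [MeasurableSpace Ω]
    (P : Measure Ω) [IsProbabilityMeasure P] (μ : Measure ℝ) [IsProbabilityMeasure μ]
    -- the random sample, with distribution `μ`
    (X : ℕ → Ω → ℝ) (hXmeas : ∀ i, Measurable (X i)) (hXindep : iIndepFun X P)
    (hXlaw : ∀ i, P.map (X i) = μ)
    -- evaluation point, kernel, basis, target parameter
    (x₀ : ℝ) (hx₀ : x₀ ∈ μ.support)
    (K : ℝ → ℝ) (hK : LocalL2.IsKernel K)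
    (R : ℝ → EuclideanSpace ℝ (Fin d)) (Υ : ℝ → Matrix (Fin d) (Fin d) ℝ)
    (hR : LocalL2.IsScalingBasis R Υ)
    (θ : EuclideanSpace ℝ (Fin d))
    -- smoothness of the distribution and of the design
    (f : ℝ → ℝ) (hf : LocalL2.HasSmoothDensityNear (cdf μ) f x₀)
    (G : StieltjesFunction ℝ) (g : ℝ → ℝ) (hgmeas : Measurable g)
    (hg : LocalL2.HasSmoothDensityNear G g x₀)
    (hev : LocalL2.EigenvaluesBoundedBelow μ R K g x₀)
    -- the bandwidth sequence
    (h : ℕ → ℝ) (hpos : ∀ n, 0 < h n) (hlim : Tendsto h atTop (𝓝 0))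
    (hnh : Tendsto (fun n : ℕ => (n : ℝ) * h n) atTop atTop)
    (hbias : Tendsto (fun n : ℕ => (n : ℝ) * LocalL2.approxError μ R x₀ θ (h n) ^ 2 / h n)
      atTop (𝓝 0))
    -- the local `L²` estimator
    (θhat : ℕ → Ω → EuclideanSpace ℝ (Fin d)) (hθmeas : ∀ n, AEMeasurable (θhat n) P)
    (hθhat : ∀ᶠ n in atTop, ∀ ω,
      LocalL2.IsLocalL2Estimate μ R K G x₀ (h n) X n ω (θhat n ω)) :
    -- the estimator is eventually well defined, with its bias / linear variance expansion
    (∀ᶠ n in atTop, ∀ ω,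
      (∃! t, LocalL2.IsLocalL2Estimate μ R K G x₀ (h n) X n ω t) ∧
      θhat n ω - θ =
        Matrix.toEuclideanLin (Υ (h n) * (LocalL2.Gam μ R K g x₀ (h n))⁻¹)
          (LocalL2.biasIntegral μ R Υ K g x₀ θ (h n)) +
        Matrix.toEuclideanLin (Υ (h n) * (LocalL2.Gam μ R K g x₀ (h n))⁻¹)
          ((n : ℝ)⁻¹ • ∑ i ∈ Finset.range n, LocalL2.influence μ R K g x₀ (h n) (X i ω))) ∧
    -- (i) the bias, without and with the design density in the integrand
    ((fun n => ‖LocalL2.biasIntegral μ R Υ K (fun _ => 1) x₀ θ (h n)‖) =O[atTop]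
        (fun n => LocalL2.approxError μ R x₀ θ (h n)) ∧
      (fun n => ‖LocalL2.biasIntegral μ R Υ K g x₀ θ (h n)‖) =O[atTop]
        (fun n => LocalL2.approxError μ R x₀ θ (h n))) ∧
    -- (ii) the variance, and asymptotic normality, of the linear term
    (∀ᶠ n in atTop, ∀ i,
      MemLp (fun ω => LocalL2.influence μ R K g x₀ (h n) (X i ω)) 2 P ∧
      ∀ j k : Fin d,
        covariance (fun ω => LocalL2.influence μ R K g x₀ (h n) (X i ω) j)
          (fun ω => LocalL2.influence μ R K g x₀ (h n) (X i ω) k) P =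
        LocalL2.Sig μ R K g x₀ (h n) j k) ∧
    TendstoInDistribution
      (fun (n : ℕ) (ω : Ω) =>
        Matrix.toEuclideanLin (LocalL2.invSqrt (LocalL2.Sig μ R K g x₀ (h n)))
          ((√(n : ℝ))⁻¹ • ∑ i ∈ Finset.range n, LocalL2.influence μ R K g x₀ (h n) (X i ω)))
      atTop (id : EuclideanSpace ℝ (Fin d) → EuclideanSpace ℝ (Fin d)) (fun _ => P)
      (multivariateGaussian 0 1) ∧
    -- (iii) asymptotic normality of the estimator
    TendstoInDistribution
      (fun (n : ℕ) (ω : Ω) =>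
        √(n : ℝ) •
          Matrix.toEuclideanLin
            (LocalL2.invSqrt
                ((LocalL2.Gam μ R K g x₀ (h n))⁻¹ * LocalL2.Sig μ R K g x₀ (h n) *
                  (LocalL2.Gam μ R K g x₀ (h n))⁻¹) *
              (Υ (h n))⁻¹)
            (θhat n ω - θ))
      atTop (id : EuclideanSpace ℝ (Fin d) → EuclideanSpace ℝ (Fin d)) (fun _ => P)
      (multivariateGaussian 0 1) := by
  obtain ⟨δ, M, hδ, hM, hint, hgb, hG⟩ := hg.exists_bound
  obtain ⟨C, hC0, hC⟩ := hK.exists_le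
  obtain ⟨D, hD0, hD⟩ := hR.exists_le
  obtain ⟨c, hc0, hev⟩ := hev
  have hsmall : ∀ᶠ n in atTop, h n < δ := hlim.eventually (gt_mem_nhds hδ)
  have hgn : ∀ᶠ n in atTop, ∀ t ∈ Icc (x₀ - h n) (x₀ + h n), 0 ≤ g t ∧ g t ≤ M := by
    filter_upwards [hsmall] with n hn t ht
    exact hgb t ⟨by linarith [ht.1], by linarith [ht.2]⟩
  have hevn := (tendsto_nhdsWithin_iff.2 ⟨hlim, .of_forall hpos⟩).eventually hev
  have hΓc : ∀ᶠ n in atTop, ∀ s : EuclideanSpace ℝ (Fin d),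
      c * ‖s‖ ^ 2 ≤ inner ℝ s (Matrix.toEuclideanLin (Gam μ R K g x₀ (h n)) s) := by
    filter_upwards [hevn, hgn] with n hn hg s
    exact mul_norm_sq_le_inner_of_le_spectrum
      (isHermitian_of_integral_mul (Gam_eq R hK hgmeas (hpos n).le hg)) hn.1 s
  have hΓpd : ∀ᶠ n in atTop, (Gam μ R K g x₀ (h n)).PosDef := by
    filter_upwards [hΓc, hgn] with n hn hg
    exact posDef_of_mul_norm_sq_le_inner
      (isHermitian_of_integral_mul (Gam_eq R hK hgmeas (hpos n).le hg)) hc0 hn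
  have hSH : ∀ᶠ n in atTop, (Sig μ R K g x₀ (h n)).IsHermitian := by
    filter_upwards [hgn] with n hg
    exact isHermitian_of_integral_mul
      (Sig_eq_integral_influence hR hK hgmeas (hpos n).le hM hg)
  have hSc : ∀ᶠ n in atTop, ∀ s : EuclideanSpace ℝ (Fin d),
      c * h n * ‖s‖ ^ 2 ≤ inner ℝ s (Matrix.toEuclideanLin (Sig μ R K g x₀ (h n)) s) := by
    filter_upwards [hevn, hSH] with n hn hH s
    have hH' : ((h n)⁻¹ • Sig μ R K g x₀ (h n)).IsHermitian := by
      rw [Matrix.IsHermitian, Matrix.conjTranspose_smul, hH.eq, star_trivial]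
    have h1 := mul_norm_sq_le_inner_of_le_spectrum hH' hn.2 s
    rw [map_smul, LinearMap.smul_apply, real_inner_smul_right, ← div_eq_inv_mul,
      le_div_iff₀ (hpos n)] at h1
    linarith
  have hSpd : ∀ᶠ n in atTop, (Sig μ R K g x₀ (h n)).PosDef := by
    filter_upwards [hSc, hSH] with n hn hH
    exact posDef_of_mul_norm_sq_le_inner hH (mul_pos hc0 (hpos n)) hn
  have hiff : ∀ᶠ n in atTop, ∀ ω t, IsLocalL2Estimate μ R K G x₀ (h n) X n ω t ↔
      t = Matrix.toEuclideanLin (Υ (h n) * (Gam μ R K g x₀ (h n))⁻¹)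
        (∫ u, empCdf X n ω (x₀ + h n * u) • R u ∂(designMeasure μ K g x₀ (h n))) := by
    filter_upwards [hsmall, hΓc, hΓpd] with n hn hΓ hpd ω t
    exact isLocalL2Estimate_iff hR hK hgmeas (hpos n) hn hM hint hgb hG hc0 hΓ hpd X n ω t
  have hexp : ∀ᶠ n in atTop, ∀ ω, θhat n ω - θ =
        Matrix.toEuclideanLin (Υ (h n) * (Gam μ R K g x₀ (h n))⁻¹)
          (biasIntegral μ R Υ K g x₀ θ (h n)) +
        Matrix.toEuclideanLin (Υ (h n) * (Gam μ R K g x₀ (h n))⁻¹)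
          ((n : ℝ)⁻¹ • ∑ i ∈ Finset.range n, influence μ R K g x₀ (h n) (X i ω)) := by
    filter_upwards [hiff, hgn, hΓpd, hθhat, eventually_ne_atTop 0] with n hn hg hpd hmin hn0 ω
    have hdet := (Matrix.isUnit_iff_isUnit_det _).1 hpd.isUnit
    rw [(hn ω _).1 (hmin ω), integral_empCdf_smul_eq hR hK hgmeas (hpos n) hM hg θ X hn0,
      map_add, map_add, ← toEuclideanLin_mul_apply, ← toEuclideanLin_mul_apply,
      Matrix.mul_assoc, Matrix.mul_assoc, Matrix.nonsing_inv_mul_cancel_left _ _ hdet,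
      Matrix.mul_nonsing_inv _ (hR.isUnit_det (hpos n)), toEuclideanLin_one_apply]
    abel
  have hBg : ∀ᶠ n in atTop, ‖biasIntegral μ R Υ K g x₀ θ (h n)‖ ≤
      D * (C * M * 2) * approxError μ R x₀ θ (h n) := by
    filter_upwards [hgn] with n hg
    exact norm_biasIntegral_le hR hK hgmeas (hpos n) hM hg θ hC0 hC hD0 hD
  have hinfl : ∀ n, Measurable (influence μ R K g x₀ (h n)) := fun n =>
    measurable_influence hR.measurable hK hgmeas
  refine ⟨?_, ⟨?_, ?_⟩, ?_, ?_, ?_⟩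
  · filter_upwards [hiff, hexp] with n hn he ω
    exact ⟨⟨_, (hn ω _).2 rfl, fun t ht => (hn ω t).1 ht⟩, he ω⟩
  -- weight `1` is the design density `g ≡ 1`, which is bounded by `1`
  · refine Asymptotics.IsBigO.of_bound (D * (C * 1 * 2)) (.of_forall fun n => ?_)
    rw [norm_norm, Real.norm_of_nonneg (hR.approxError_nonneg (hpos n) θ)]
    exact norm_biasIntegral_le hR hK measurable_const (hpos n) zero_le_one
      (fun t _ => ⟨zero_le_one, le_rfl⟩) θ hC0 hC hD0 hD
  · refine Asymptotics.IsBigO.of_bound (D * (C * M * 2)) ?_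
    filter_upwards [hBg] with n hn
    rwa [norm_norm, Real.norm_of_nonneg (hR.approxError_nonneg (hpos n) θ)]
  · filter_upwards [hgn] with n hg i
    exact ⟨memLp_influence (hXmeas i) hR hK hgmeas (hpos n).le hM hg, fun j k =>
      covariance_influence (hXmeas i) (hXlaw i) hR hK hgmeas (hpos n).le hM hg j k⟩
  · refine tendstoInDistribution_standardized_influence hXmeas hXindep hXlaw hR hK hgmeas hpos
      hM hgn hnh hc0 hSc (A := fun n => invSqrt (Sig μ R K g x₀ (h n))) (B := fun _ => 0) ?_
      (by simp) (fun n => ?_) (.of_forall fun n ω => by rw [zero_add])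
    · filter_upwards [hSpd] with n hn using invSqrt_mul_mul_transpose hn
    · have hsum : Measurable fun ω =>
          ∑ i ∈ Finset.range n, influence μ R K g x₀ (h n) (X i ω) :=
        Finset.measurable_fun_sum _ fun i _ => (hinfl n).comp (hXmeas i)
      have hsmul : Measurable fun ω =>
          (√(n : ℝ))⁻¹ • ∑ i ∈ Finset.range n, influence μ R K g x₀ (h n) (X i ω) :=
        Measurable.const_smul hsum (√(n : ℝ))⁻¹
      exact ((measurable_toEuclideanLin _).comp hsmul).aemeasurable
  · refine tendstoInDistribution_standardized_influence hXmeas hXindep hXlaw hR hK hgmeas hpos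
      hM hgn hnh hc0 hSc
      (A := fun n => invSqrt ((Gam μ R K g x₀ (h n))⁻¹ * Sig μ R K g x₀ (h n) *
        (Gam μ R K g x₀ (h n))⁻¹) * (Gam μ R K g x₀ (h n))⁻¹)
      (B := fun n => √(n : ℝ) • biasIntegral μ R Υ K g x₀ θ (h n)) ?_ ?_ (fun n => ?_) ?_
    · filter_upwards [hSpd, hΓpd] with n h1 h2 using invSqrt_sandwich_mul_mul_transpose h1 h2
    -- `h^{-1/2} √n ‖B_h‖` is at most a multiple of `√(n ϱ(h)² / h)`
    · have h1 : Tendsto (fun n : ℕ => D * (C * M * 2) *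
          √((n : ℝ) * approxError μ R x₀ θ (h n) ^ 2 / h n)) atTop (𝓝 0) := by
        simpa using ((Real.continuous_sqrt.tendsto 0).comp hbias).const_mul (D * (C * M * 2))
      refine squeeze_zero' (.of_forall fun n => by positivity) ?_ h1
      filter_upwards [hBg] with n hn
      have hϱ := hR.approxError_nonneg (μ := μ) (x₀ := x₀) (hpos n) θ
      rw [norm_smul, Real.norm_of_nonneg (Real.sqrt_nonneg _), Real.sqrt_div' _ (hpos n).le,
        Real.sqrt_mul (Nat.cast_nonneg n), Real.sqrt_sq hϱ]
      calc (√(h n))⁻¹ * (√(n : ℝ) * ‖biasIntegral μ R Υ K g x₀ θ (h n)‖)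
          ≤ (√(h n))⁻¹ * (√(n : ℝ) * (D * (C * M * 2) * approxError μ R x₀ θ (h n))) := by
            gcongr
        _ = _ := by ring
    · exact AEMeasurable.const_smul ((measurable_toEuclideanLin _).comp_aemeasurable
        ((hθmeas n).sub_const θ)) √(n : ℝ)
    · filter_upwards [hexp] with n hn ω
      have hU := hR.isUnit_det (hpos n)
      have hsq : √(n : ℝ) * (n : ℝ)⁻¹ = (√(n : ℝ))⁻¹ := by
        rw [← div_eq_mul_inv, Real.sqrt_div_self]
      rw [hn ω, ← map_add, ← toEuclideanLin_mul_apply, Matrix.mul_assoc,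
        Matrix.nonsing_inv_mul_cancel_left _ _ hU, ← map_smul, smul_add, smul_smul, hsq]
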